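/- **Setting.** Let $0<\alpha<1$, $\beta:=1-\alpha$, $\kappa,\epsilon>0$, let $\Omega=(0,L_1)\times(0,L_2)$ with periodic boundary conditions, and let $\|\cdot\|$ be the $L^2(\Omega)$ norm. Let $0=t_0<t_1<\dots<t_N$, $\tau_k=t_k-t_{k-1}$, $r_k=\tau_k/\tau_{k-1}$, and write $\nabla_\tau w^k=w^k-w^{k-1}$, $\partial_\tau w^k=\nabla_\tau w^k/\tau_k$, $w^{k-1/2}=\tfrac12(w^k+w^{k-1})$. With $\omega_\beta(t)=t^{\beta-1}/\Gamma(\beta)$ put, for $1\le k\le n\le N$, $$a^{(n)}_{n-k}=\frac1{\tau_n\tau_k}\int_{t_{n-1}}^{t_n}\int_{t_{k-1}}^{\min\{t,t_k\}}\omega_{\beta}(t-s)\,ds\,dt,\qquad \mathsf a^{(n)}_0=2a^{(n)}_0,\quad \mathsf a^{(n)}_{n-k}=a^{(n)}_{n-k}\ (k<n).$$ Let $\theta_0^{(n)}=1/\mathsf a_0^{(n)}$, $\theta_{n-k}^{(n)}=-\frac1{\mathsf a_0^{(k)}}\sum_{j=k+1}^n\theta_{n-j}^{(n)}\mathsf a_{j-k}^{(j)}$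 for $1\le k\le n-1$, and let $$\mathsf p^{(n)}_{n-k}=\sum_{j=k}^n\theta^{(j)}_{j-k},\qquad \tilde{\mathsf p}^{(n)}_{n-k}=\sum_{j=k}^n\theta^{(n)}_{n-j}\qquad(1\le k\le n)$$ be the left- and right-complementary convolution kernels (DCC and RCC) of the modified kernels $\mathsf a$. Assume the step-ratio constraint $$r_{k+1}\ge r_*(r_k)\quad(2\le k\le N-1),\qquad r_*(z)=\Big[\frac{(2^\beta-1)\rho(z)}{\rho(2z)-\rho(z)}\Big]^{\frac1{1-\beta}},\quad \rho(z)=(z+1)^{1+\beta}-z^{1+\beta}-1.$$ Let $\phi^0,\dots,\phi^N\in H^1_{per}(\Omega)$ (the closure of the smooth periodic functions in $H^1(\Omega)$) solve the $L1^+$ Crank–Nicolson scheme for the time-fractional Allen–Cahn equation: for $1\le n\le N$, $$\sum_{k=1}^na^{(n)}_{n-k}\nabla_\tau\phi^k=-\kappa\mu^{n-\frac12},\qquad \mu^{n-\frac12}=\tfrac12\big[(\phi^n)^2+(\phi^{n-1})^2\big]\phi^{n-\frac12}-\phi^{n-\frac12}-\epsilon^2\Delta\phi^{n-\frac12},$$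 in the weak sense against all smooth periodic test functions. Put $v^j=\sum_{\ell=1}^j\mathsf a^{(j)}_{j-\ell}\nabla_\tau\phi^\ell$ for $0\le j\le N$ (so $v^0=0$) and $$E[\phi]=\int_\Omega\Big(\frac{\epsilon^2}2|\nabla\phi|^2+\frac14(\phi^2-1)^2\Big)dx,\qquad E_\alpha[\phi^n]=E[\phi^n]+\frac1{2\kappa}\sum_{j=1}^n\mathsf p^{(n)}_{n-j}\|v^j\|^2 .$$ **Theorem.** For every $1\le n\le N$, $$\partial_\tau E_\alpha[\phi^n]+\frac1{2\kappa\tau_n}\sum_{j=1}^{n-1}\Big(\frac1{\tilde{\mathsf p}^{(n)}_{n-j}}-\frac1{\tilde{\mathsf p}^{(n)}_{n-j-1}}\Big)\Big\|\sum_{k=1}^j\tilde{\mathsf p}^{(n)}_{n-k}\nabla_\tau v^k\Big\|^2=0 .$$ Here all $\tilde{\mathsf p}^{(n)}_{n-k}$ $(1\le k\le n)$ are positive and all coefficients $1/\tilde{\mathsf p}^{(n)}_{n-j}-1/\tilde{\mathsf p}^{(n)}_{n-j-1}$ $(1\le j\le n-1)$ are nonnegative, so that the law is dissipative: $E_\alpha[\phi^n]\le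 E_\alpha[\phi^{n-1}]$. -/

import Mathlib

open MeasureTheory Filter Topology

noncomputable section

namespace TFAC

/-! ### Time mesh

A mesh is a sequence `t`, of which only the levels `t 0 < t 1 < ⋯ < t N` are used. -/

/-- The step size `τ_k = t_k - t_{k-1}` (for `k ≥ 1`). -/
def step (t : ℕ → ℝ) (k : ℕ) : ℝ := t k - t (k - 1)

/-- The step ratio `r_k = τ_k / τ_{k-1}` (for `k ≥ 2`). -/
def ratio (t : ℕ → ℝ) (k : ℕ) : ℝ := step t k / step t (k - 1)

/-- The backward difference `w^k - w^{k-1}` (for `k ≥ 1`). -/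
def diff {E : Type*} [Sub E] (w : ℕ → E) (k : ℕ) : E := w k - w (k - 1)

/-- The mean `w^{k-1/2} = (w^k + w^{k-1}) / 2` (for `k ≥ 1`). -/
def mid {E : Type*} [AddCommGroup E] [Module ℝ E] (w : ℕ → E) (k : ℕ) : E :=
  (2⁻¹ : ℝ) • (w k + w (k - 1))

/-- `ρ(z) = (z+1)^{1+β} - z^{1+β} - 1`. -/
def rho (β z : ℝ) : ℝ := (z + 1) ^ (1 + β) - z ^ (1 + β) - 1

/-- `r_*(z) = [(2^β - 1) ρ(z) / (ρ(2z) - ρ(z))]^{1/(1-β)}`. -/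
def rStar (β z : ℝ) : ℝ :=
  (((2 : ℝ) ^ β - 1) * rho β z / (rho β (2 * z) - rho β z)) ^ (1 / (1 - β))

/-- The step-ratio constraint `r_{k+1} ≥ r_*(r_k)` for `k ≥ 2`, on the mesh `t_0, …, t_N`. -/
def StepRatioConstraint (β : ℝ) (t : ℕ → ℝ) (N : ℕ) : Prop :=
  ∀ k, 2 ≤ k → k + 1 ≤ N → rStar β (ratio t k) ≤ ratio t (k + 1)

/-! ### Discrete convolution kernels

A family of kernels `a_{n-k}^{(n)}`, `1 ≤ k ≤ n`, is a function `a : ℕ → ℕ → ℝ` whose value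
`a n k` is `a_{n-k}^{(n)}`: the second argument is the time index `k`, not the lag `n - k`. -/

/-- `ω_β(x) = x^{β-1} / Γ(β)`. -/
def omega (β x : ℝ) : ℝ := x ^ (β - 1) / Real.Gamma β

/-- The averaged kernels
`a_{n-k}^{(β,n)} = (τ_n τ_k)⁻¹ ∫_{t_{n-1}}^{t_n} ∫_{t_{k-1}}^{min{s, t_k}} ω_β(s - r) dr ds`. -/
def kernel (β : ℝ) (t : ℕ → ℝ) (n k : ℕ) : ℝ :=
  1 / (step t n * step t k) *
    ∫ s in (t (n - 1))..(t n), ∫ r in (t (k - 1))..(min s (t k)), omega β (s - r)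

/-- The modified kernels: the leading kernel (lag `0`) is doubled. -/
def modKernel (β : ℝ) (t : ℕ → ℝ) (n k : ℕ) : ℝ :=
  if k = n then 2 * kernel β t n n else kernel β t n k

/-- The discrete orthogonal convolution (DOC) kernels `θ_{n-k}^{(n)}` of `a`:
`θ_0^{(n)} = 1 / a_0^{(n)}` and
`θ_{n-k}^{(n)} = - (1 / a_0^{(k)}) ∑_{j=k+1}^n θ_{n-j}^{(n)} a_{j-k}^{(j)}` for `k < n`. -/
def doc (a : ℕ → ℕ → ℝ) (n k : ℕ) : ℝ :=
  if k < n then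
    -(1 / a k k) * ∑ j ∈ (Finset.Icc (k + 1) n).attach, doc a n j.1 * a j.1 k
  else 1 / a n n
termination_by n - k
decreasing_by
  have h := Finset.mem_Icc.mp j.2
  omega

/-- The discrete (left-)complementary convolution (DCC) kernels
`p_{n-k}^{(n)} = ∑_{j=k}^n θ_{j-k}^{(j)}`. -/
def dcc (a : ℕ → ℕ → ℝ) (n k : ℕ) : ℝ := ∑ j ∈ Finset.Icc k n, doc a j k

/-- The right-complementary convolution (RCC) kernels
`p̃_{n-k}^{(n)} = ∑_{j=k}^n θ_{n-j}^{(n)}`. -/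
def rcc (a : ℕ → ℕ → ℝ) (n k : ℕ) : ℝ := ∑ j ∈ Finset.Icc k n, doc a n j

/-! ### The periodic cell and the energy space -/

/-- The rectangle `Ω = (0, L₀) × (0, L₁)`. -/
def cell (L : Fin 2 → ℝ) : Set (Fin 2 → ℝ) := Set.univ.pi fun i => Set.Ioo 0 (L i)

/-- Lebesgue measure on `Ω`. -/
def vol (L : Fin 2 → ℝ) : Measure (Fin 2 → ℝ) := volume.restrict (cell L)

/-- The square of the `L²(Ω)` norm. -/
def normSq (L : Fin 2 → ℝ) (u : (Fin 2 → ℝ) → ℝ) : ℝ := ∫ x, u x ^ 2 ∂(vol L)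

/-- The classical partial derivative `∂_i ψ`. -/
def pderiv (i : Fin 2) (ψ : (Fin 2 → ℝ) → ℝ) (x : Fin 2 → ℝ) : ℝ :=
  fderiv ℝ ψ x (Pi.single i 1)

/-- Smooth `Ω`-periodic functions on the plane. -/
def IsSmoothPeriodic (L : Fin 2 → ℝ) (ψ : (Fin 2 → ℝ) → ℝ) : Prop :=
  ContDiff ℝ (⊤ : ℕ∞) ψ ∧ ∀ x i, ψ (x + Pi.single i (L i)) = ψ x

/-- `u` belongs to the periodic energy space and has gradient `g`: on `Ω`, `(u, g)` is the limit
of `(ψ_m, ∇ψ_m)` in `L⁴ × L²` for smooth periodic `ψ_m`. In two dimensions `H¹_per(Ω)` embeds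
into `L⁴(Ω)`, so this space is `H¹_per(Ω)`, the closure of the smooth periodic functions in the
`H¹` norm, and `g` is the weak gradient of `u`. -/
def HasPeriodicGrad (L : Fin 2 → ℝ) (u : (Fin 2 → ℝ) → ℝ) (g : Fin 2 → (Fin 2 → ℝ) → ℝ) : Prop :=
  MemLp u 4 (vol L) ∧ (∀ i, MemLp (g i) 2 (vol L)) ∧
  ∃ ψ : ℕ → (Fin 2 → ℝ) → ℝ, (∀ m, IsSmoothPeriodic L (ψ m)) ∧
    Tendsto (fun m => eLpNorm (ψ m - u) 4 (vol L)) atTop (𝓝 0) ∧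
    ∀ i, Tendsto (fun m => eLpNorm (pderiv i (ψ m) - g i) 2 (vol L)) atTop (𝓝 0)

/-! ### The Crank–Nicolson scheme and its energies

`φ n` is the numerical solution at the time level `t_n` and `g n` its gradient. -/

/-- The Ginzburg–Landau energy `∫_Ω (ε²/2 |∇u|² + (u² - 1)²/4) dx`, where `g = ∇u`. -/
def energy (L : Fin 2 → ℝ) (ε : ℝ) (u : (Fin 2 → ℝ) → ℝ) (g : Fin 2 → (Fin 2 → ℝ) → ℝ) : ℝ :=
  ∫ x, (ε ^ 2 / 2 * ∑ i, g i x ^ 2 + 1 / 4 * (u x ^ 2 - 1) ^ 2) ∂(vol L)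

/-- The `L1⁺` discrete Caputo derivative
`(∂_τ^α φ)^{n-1/2} = ∑_{k=1}^n a_{n-k}^{(1-α,n)} (φ^k - φ^{k-1})`. -/
def caputo (α : ℝ) (t : ℕ → ℝ) (φ : ℕ → (Fin 2 → ℝ) → ℝ) (n : ℕ) : (Fin 2 → ℝ) → ℝ :=
  ∑ k ∈ Finset.Icc 1 n, kernel (1 - α) t n k • diff φ k

/-- `f(φ)^{n-1/2} = ½ [(φ^n)² + (φ^{n-1})²] φ^{n-1/2} - φ^{n-1/2}`. -/
def fMid (φ : ℕ → (Fin 2 → ℝ) → ℝ) (n : ℕ) (x : Fin 2 → ℝ) : ℝ :=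
  1 / 2 * (φ n x ^ 2 + φ (n - 1) x ^ 2) * mid φ n x - mid φ n x

/-- The pairing of `μ^{n-1/2} = f(φ)^{n-1/2} - ε² Δφ^{n-1/2}` with a smooth periodic `ψ`; the
periodic Laplacian is taken in the weak sense, `⟨-Δu, ψ⟩ = ∫_Ω ∇u · ∇ψ dx`. -/
def muPairing (L : Fin 2 → ℝ) (ε : ℝ) (φ : ℕ → (Fin 2 → ℝ) → ℝ)
    (g : ℕ → Fin 2 → (Fin 2 → ℝ) → ℝ) (n : ℕ) (ψ : (Fin 2 → ℝ) → ℝ) : ℝ :=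
  (∫ x, fMid φ n x * ψ x ∂(vol L)) +
    ε ^ 2 * ∫ x, (∑ i, mid g n i x * pderiv i ψ x) ∂(vol L)

/-- `φ^0, …, φ^N` lie in the periodic energy space, with gradients `g^0, …, g^N`, and solve
`(∂_τ^α φ)^{n-1/2} = -κ μ^{n-1/2}`, `1 ≤ n ≤ N`, weakly against all smooth periodic functions. -/
structure IsCNSolution (L : Fin 2 → ℝ) (α κ ε : ℝ) (t : ℕ → ℝ) (N : ℕ)
    (φ : ℕ → (Fin 2 → ℝ) → ℝ) (g : ℕ → Fin 2 → (Fin 2 → ℝ) → ℝ) : Prop where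
  hasGrad : ∀ n, n ≤ N → HasPeriodicGrad L (φ n) (g n)
  scheme : ∀ n, 1 ≤ n → n ≤ N → ∀ ψ, IsSmoothPeriodic L ψ →
    ∫ x, caputo α t φ n x * ψ x ∂(vol L) = -κ * muPairing L ε φ g n ψ

/-- `v^j = ∑_{ℓ=1}^j 𝖺_{j-ℓ}^{(1-α,j)} (φ^ℓ - φ^{ℓ-1})`; in particular `v^0 = 0`. -/
def vSeq (α : ℝ) (t : ℕ → ℝ) (φ : ℕ → (Fin 2 → ℝ) → ℝ) (j : ℕ) : (Fin 2 → ℝ) → ℝ :=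
  ∑ l ∈ Finset.Icc 1 j, modKernel (1 - α) t j l • diff φ l

/-- The discrete variational energy
`E_α[φ^n] = E[φ^n] + 1/(2κ) ∑_{j=1}^n 𝗉_{n-j}^{(1-α,n)} ‖v^j‖²`. -/
def energyAlpha (L : Fin 2 → ℝ) (α κ ε : ℝ) (t : ℕ → ℝ) (φ : ℕ → (Fin 2 → ℝ) → ℝ)
    (g : ℕ → Fin 2 → (Fin 2 → ℝ) → ℝ) (n : ℕ) : ℝ :=
  energy L ε (φ n) (g n) +
    1 / (2 * κ) * ∑ j ∈ Finset.Icc 1 n,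
      dcc (modKernel (1 - α) t) n j * normSq L (vSeq α t φ j)

end TFAC

end

namespace TFAC

/-! ### Orthogonal and complementary kernels -/

/-! Write `θ` for the DOC kernels, the inverse of the lower triangular matrix of modified kernels,
and `P` for the RCC kernels of row `n`. Inverting `v = 𝖺 ∇φ` gives `∇φ^n = S`, where `S = ∑ θ v = ∑
P ∇v`. Since only the leading kernel is doubled, the left side of the scheme is `v^n - ½ 𝖺_0 ∇φ^n`,
so twice its product with `∇φ^n` is the quadratic form `2 v^n S - S²/θ_0`. A telescoping identity
(`sum_doc_mul_sq_add`) splits this form into `∑ θ_{n-j} (v^j)²`, which after integration is the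
increment of the memory part of the energy, and the squares of the partial sums of `∑ P ∇v`. On the
other side of the scheme, the Crank–Nicolson nonlinearity makes `⟨μ, ∇φ^n⟩` exactly the increment of
`E` (`energy_sub`). This is why the law is an equality. The test function `∇φ^n` is not smooth; it
is reached by density in `L⁴ × L²` (`scheme_of_hasPeriodicGrad`).

The signs are a separate question about the matrix. Its off-diagonal inverse entries are nonpositive
once quotients of neighbouring columns increase down the rows (`doc_nonpos`); this makes `P`
nondecreasing in the time index, and decay of the first column makes it positive (`rcc_pos`). Away
from the diagonal the quotient condition is inherited from `ω_β`. At the doubled diagonal entry it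
becomes an inequality for `ρ` at two neighbouring step ratios (`rho_mul_rho_le`), and there the
step-ratio constraint enters. -/

theorem doc_self (a : ℕ → ℕ → ℝ) (n : ℕ) : doc a n n = 1 / a n n := by
  rw [doc, if_neg (lt_irrefl n)]

theorem doc_of_lt (a : ℕ → ℕ → ℝ) {n k : ℕ} (h : k < n) :
    doc a n k = -(1 / a k k) * ∑ j ∈ Finset.Icc (k + 1) n, doc a n j * a j k := by
  rw [doc, if_pos h, Finset.sum_attach (Finset.Icc (k + 1) n) (fun j => doc a n j * a j k)]

theorem sum_Icc_eq_add {M : Type*} [AddCommMonoid M] (f : ℕ → M) {k n : ℕ} (h : k ≤ n) :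
    ∑ j ∈ Finset.Icc k n, f j = f k + ∑ j ∈ Finset.Icc (k + 1) n, f j := by
  rw [← Finset.insert_Icc_add_one_left_eq_Icc h, Finset.sum_insert (by simp)]

/-- The DOC kernels invert the lower triangular kernel matrix. -/
theorem sum_doc_mul_eq_zero {a : ℕ → ℕ → ℝ} {n k : ℕ} (hk : a k k ≠ 0) (h : k < n) :
    ∑ j ∈ Finset.Icc k n, doc a n j * a j k = 0 := by
  rw [sum_Icc_eq_add _ h.le, doc_of_lt a h]
  field_simp
  ring

/-- The DOC kernels recover the increments from their discrete convolution with `a`. -/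
theorem sum_doc_mul_convolution {a : ℕ → ℕ → ℝ} {n : ℕ} (hn : 1 ≤ n)
    (ha : ∀ k, 1 ≤ k → k ≤ n → a k k ≠ 0) (w : ℕ → ℝ) :
    ∑ j ∈ Finset.Icc 1 n, doc a n j * ∑ l ∈ Finset.Icc 1 j, a j l * w l = w n := by
  simp_rw [Finset.mul_sum]
  rw [Finset.sum_comm' (t' := Finset.Icc 1 n) (s' := fun l => Finset.Icc l n)
    (by intro x y; simp only [Finset.mem_Icc]; omega)]
  rw [Finset.sum_eq_single_of_mem n (by simp [hn])]
  · rw [Finset.Icc_self, Finset.sum_singleton, doc_self]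
    have := ha n hn le_rfl
    field_simp
  · intro l hl hln
    have hl' := Finset.mem_Icc.mp hl
    have := sum_doc_mul_eq_zero (ha l hl'.1 hl'.2) (lt_of_le_of_ne hl'.2 hln)
    simp_rw [← mul_assoc]
    rw [← Finset.sum_mul, this, zero_mul]

/-- The off-diagonal DOC kernels are nonpositive if the quotients of neighbouring columns of the
kernel matrix increase down the rows. -/
theorem doc_nonpos {a : ℕ → ℕ → ℝ} {n : ℕ}
    (hpos : ∀ k j, 1 ≤ k → k ≤ j → j ≤ n → 0 < a j k)
    (hq : ∀ k j, 1 ≤ k → k + 1 ≤ j → j ≤ n → a j k * a n (k + 1) ≤ a n k * a j (k + 1)) :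
    ∀ k, 1 ≤ k → k < n → doc a n k ≤ 0 := by
  intro k
  induction hd : n - k using Nat.strong_induction_on generalizing k with
  | _ d ih =>
    intro hk hkn
    have hkk := hpos k k hk le_rfl hkn.le
    rw [doc_of_lt a hkn]
    have key : 0 ≤ ∑ j ∈ Finset.Icc (k + 1) n, doc a n j * a j k := by
      rcases Nat.lt_or_ge (k + 1) n with h | h
      · have h0 := sum_doc_mul_eq_zero (a := a) (hpos (k + 1) (k + 1) (by omega) le_rfl h.le).ne' h
        have hn1 := hpos (k + 1) n (by omega) h.le le_rfl
        -- Subtract `a n k` times the vanishing relation for column `k + 1`. The term `j = n`, the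
        -- only one with a positive DOC kernel, then drops out; every other term is a product of two
        -- nonpositive factors.
        have : ∑ j ∈ Finset.Icc (k + 1) n, doc a n j * a j k * a n (k + 1)
            = ∑ j ∈ Finset.Icc (k + 1) n,
              doc a n j * (a j k * a n (k + 1) - a n k * a j (k + 1)) := by
          have : ∑ j ∈ Finset.Icc (k + 1) n, doc a n j * a j (k + 1) * a n k = 0 := by
            rw [← Finset.sum_mul, h0, zero_mul]
          rw [← sub_zero (∑ j ∈ Finset.Icc (k + 1) n, doc a n j * a j k * a n (k + 1)), ← this,
            ← Finset.sum_sub_distrib]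
          exact Finset.sum_congr rfl fun j _ => by ring
        rw [← Finset.sum_mul] at this
        refine nonneg_of_mul_nonneg_left ?_ hn1
        rw [this]
        refine Finset.sum_nonneg fun j hj => ?_
        have hj' := Finset.mem_Icc.mp hj
        rcases eq_or_lt_of_le hj'.2 with rfl | hlt
        · rw [sub_self, mul_zero]
        · exact mul_nonneg_of_nonpos_of_nonpos
            (ih (n - j) (by omega) j rfl (by omega) hlt)
            (sub_nonpos.mpr (hq k j hk hj'.1 hj'.2))
      · obtain rfl : n = k + 1 := by omega
        rw [Finset.Icc_self, Finset.sum_singleton, doc_self]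
        have h1 := hpos (k + 1) (k + 1) (by omega) le_rfl le_rfl
        have h2 := hpos k (k + 1) hk (by omega) le_rfl
        positivity
    have : 0 < 1 / a k k := by positivity
    nlinarith

/-! ### Right-complementary kernels: monotonicity, positivity and summation by parts -/

theorem rcc_self (a : ℕ → ℕ → ℝ) (n : ℕ) : rcc a n n = doc a n n := by
  simp [rcc]

theorem rcc_eq_add (a : ℕ → ℕ → ℝ) {n k : ℕ} (h : k ≤ n) :
    rcc a n k = doc a n k + rcc a n (k + 1) := sum_Icc_eq_add _ h

theorem rcc_le_rcc_succ {a : ℕ → ℕ → ℝ} {n : ℕ} (hθ : ∀ k, 1 ≤ k → k < n → doc a n k ≤ 0)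
    {k : ℕ} (hk : 1 ≤ k) (hkn : k < n) : rcc a n k ≤ rcc a n (k + 1) := by
  rw [rcc_eq_add a hkn.le]
  linarith [hθ k hk hkn]

/-- If the off-diagonal DOC kernels are nonpositive and the first column of the kernel matrix
decreases, then the RCC kernels are positive. -/
theorem rcc_pos {a : ℕ → ℕ → ℝ} {n : ℕ}
    (hpos : ∀ k j, 1 ≤ k → k ≤ j → j ≤ n → 0 < a j k)
    (hθ : ∀ k, 1 ≤ k → k < n → doc a n k ≤ 0)
    (hdec : ∀ j, 1 ≤ j → j + 1 ≤ n → a (j + 1) 1 < a j 1) :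
    ∀ k, 1 ≤ k → k ≤ n → 0 < rcc a n k := by
  have hanti : ∀ j, 1 ≤ j → ∀ m, j ≤ m → m ≤ n → a m 1 ≤ a j 1 := by
    intro j hj m hjm
    induction m, hjm using Nat.le_induction with
    | base => intro _; exact le_rfl
    | succ m hm ih => intro h; exact (hdec m (by omega) h).le.trans (ih (by omega))
  have hone : 1 ≤ n → 0 < rcc a n 1 := by
    intro hn
    have hnn := hpos n n hn le_rfl le_rfl
    rcases eq_or_lt_of_le hn with rfl | hn2
    · rw [rcc_self, doc_self]; positivity
    · have h0 := sum_doc_mul_eq_zero (a := a) (hpos 1 1 le_rfl le_rfl hn).ne' hn2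
      have hn1 := hpos 1 n le_rfl hn le_rfl
      refine pos_of_mul_pos_left (b := a n 1) ?_ hn1.le
      -- Compare with the orthogonality relation `∑ θ_j a_{j,1} = 0`: replacing `a j 1` by the
      -- smaller `a n 1` raises the terms with `θ_j ≤ 0` and fixes the term `j = n`. Strictness
      -- comes from `j = n - 1`, where `θ_j` is explicit and negative.
      rw [rcc, Finset.sum_mul, ← h0]
      refine Finset.sum_lt_sum (fun j hj => ?_) ⟨n - 1, by simp; omega, ?_⟩
      · have hj' := Finset.mem_Icc.mp hj
        rcases eq_or_lt_of_le hj'.2 with rfl | hlt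
        · exact le_rfl
        · exact mul_le_mul_of_nonpos_left (hanti j hj'.1 n hj'.2 le_rfl) (hθ j hj'.1 hlt)
      · obtain ⟨m, rfl⟩ : ∃ m, n = m + 1 := ⟨n - 1, by omega⟩
        simp only [Nat.add_sub_cancel]
        refine mul_lt_mul_of_neg_left (hdec m (by omega) le_rfl) ?_
        rw [doc_of_lt a (Nat.lt_succ_self m), Finset.Icc_self, Finset.sum_singleton, doc_self]
        have h1 := hpos m m (by omega) le_rfl (by omega)
        have h2 := hpos m (m + 1) (by omega) (by omega) le_rfl
        have : 0 < 1 / a m m * (1 / a (m + 1) (m + 1) * a (m + 1) m) := by positivity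
        linarith
  intro k hk
  induction k, hk using Nat.le_induction with
  | base => exact hone
  | succ k hk ih =>
    intro h
    exact (ih (by omega)).trans_le (rcc_le_rcc_succ hθ hk h)

/-- Summation by parts against the RCC kernels. -/
theorem sum_rcc_mul_diff (a : ℕ → ℕ → ℝ) (n : ℕ) (v : ℕ → ℝ) (hv : v 0 = 0) {m : ℕ} (hm : m ≤ n) :
    ∑ k ∈ Finset.Icc 1 m, rcc a n k * diff v k
      = ∑ k ∈ Finset.Icc 1 m, doc a n k * v k + rcc a n (m + 1) * v m := by
  induction m with
  | zero => simp [hv]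
  | succ m ih =>
    rw [Finset.sum_Icc_succ_top (by omega), Finset.sum_Icc_succ_top (by omega), ih (by omega),
      rcc_eq_add a hm, diff, Nat.add_sub_cancel]
    ring

theorem sum_rcc_mul_diff_self (a : ℕ → ℕ → ℝ) (n : ℕ) (v : ℕ → ℝ) (hv : v 0 = 0) :
    ∑ k ∈ Finset.Icc 1 n, rcc a n k * diff v k = ∑ k ∈ Finset.Icc 1 n, doc a n k * v k := by
  rw [sum_rcc_mul_diff a n v hv le_rfl, rcc,
    Finset.Icc_eq_empty (a := n + 1) (by omega)]
  simp

/-- The algebraic identity behind the discrete energy law. -/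
theorem sum_doc_mul_sq_add {a : ℕ → ℕ → ℝ} {n : ℕ} (hn : 1 ≤ n)
    (hP : ∀ k, 1 ≤ k → k ≤ n → rcc a n k ≠ 0) (v : ℕ → ℝ) (hv : v 0 = 0) :
    ∑ j ∈ Finset.Icc 1 n, doc a n j * v j ^ 2
      + ∑ j ∈ Finset.Icc 1 (n - 1), (1 / rcc a n j - 1 / rcc a n (j + 1)) *
          (∑ k ∈ Finset.Icc 1 j, rcc a n k * diff v k) ^ 2
      = 2 * v n * (∑ k ∈ Finset.Icc 1 n, doc a n k * v k)
        - (∑ k ∈ Finset.Icc 1 n, doc a n k * v k) ^ 2 / doc a n n := by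
  rw [← sum_rcc_mul_diff_self a n (fun k => v k ^ 2) (by simp [hv]),
    ← sum_rcc_mul_diff_self a n v hv, ← rcc_self]
  obtain ⟨m, rfl⟩ : ∃ m, n = m + 1 := ⟨n - 1, by omega⟩
  simp only [Nat.add_sub_cancel]
  -- The row `m + 1` stays fixed and only the upper limit of summation varies. The last denominator
  -- is then `rcc a (m + 1) (i + 1)`, which is the leading DOC kernel when `i = m`.
  suffices H : ∀ i, i ≤ m →
      ∑ k ∈ Finset.Icc 1 (i + 1), rcc a (m + 1) k * diff (fun k => v k ^ 2) k
      + ∑ j ∈ Finset.Icc 1 i, (1 / rcc a (m + 1) j - 1 / rcc a (m + 1) (j + 1)) *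
          (∑ k ∈ Finset.Icc 1 j, rcc a (m + 1) k * diff v k) ^ 2
      = 2 * v (i + 1) * (∑ k ∈ Finset.Icc 1 (i + 1), rcc a (m + 1) k * diff v k)
        - (∑ k ∈ Finset.Icc 1 (i + 1), rcc a (m + 1) k * diff v k) ^ 2
          / rcc a (m + 1) (i + 1) from H m le_rfl
  intro i
  induction i with
  | zero =>
    intro _
    have := hP 1 le_rfl hn
    simp [diff, hv]
    field_simp
    ring
  | succ i ih =>
    intro hi
    have h1 := hP (i + 1) (by omega) (by omega)
    have h2 := hP (i + 1 + 1) (by omega) (by omega)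
    have e := ih (by omega)
    rw [Finset.sum_Icc_succ_top (by omega) (fun k => rcc a (m + 1) k * diff (fun k => v k ^ 2) k),
      Finset.sum_Icc_succ_top (b := i) (by omega) (fun j =>
        (1 / rcc a (m + 1) j - 1 / rcc a (m + 1) (j + 1)) *
          (∑ k ∈ Finset.Icc 1 j, rcc a (m + 1) k * diff v k) ^ 2),
      Finset.sum_Icc_succ_top (b := i + 1) (by omega) (fun k => rcc a (m + 1) k * diff v k)]
    generalize ∑ k ∈ Finset.Icc 1 (i + 1), rcc a (m + 1) k * diff v k = S at *
    have hd : ∀ w : ℕ → ℝ, diff w (i + 1 + 1) = w (i + 1 + 1) - w (i + 1) := fun w => rfl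
    rw [hd, hd]
    generalize ∑ k ∈ Finset.Icc 1 (i + 1), rcc a (m + 1) k * diff (fun k => v k ^ 2) k = T at *
    generalize ∑ j ∈ Finset.Icc 1 i, (1 / rcc a (m + 1) j - 1 / rcc a (m + 1) (j + 1)) *
          (∑ k ∈ Finset.Icc 1 j, rcc a (m + 1) k * diff v k) ^ 2 = U at *
    -- With `p`, `q` the RCC kernels at `i + 1`, `i + 2` and `d = v (i+2) - v (i+1)`, what remains
    -- is `2 v_{i+2} (S + q d) - (S + q d)²/q - 2 v_{i+1} S + S²/p = q (v_{i+2}² - v_{i+1}²) + (1/p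
    -- - 1/q) S²`.
    have e' : T = 2 * v (i + 1) * S - S ^ 2 / rcc a (m + 1) (i + 1) - U := by linarith
    rw [e']
    field_simp
    ring

theorem dcc_succ (a : ℕ → ℕ → ℝ) {n j : ℕ} (h : j ≤ n) :
    dcc a (n + 1) j = dcc a n j + doc a (n + 1) j :=
  Finset.sum_Icc_succ_top (by omega) _

/-- The increment of a convolution with the DCC kernels is a convolution with the DOC kernels. -/
theorem diff_sum_dcc_mul (a : ℕ → ℕ → ℝ) (w : ℕ → ℝ) {n : ℕ} (hn : 1 ≤ n) :
    diff (fun n => ∑ j ∈ Finset.Icc 1 n, dcc a n j * w j) n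
      = ∑ j ∈ Finset.Icc 1 n, doc a n j * w j := by
  obtain ⟨m, rfl⟩ : ∃ m, n = m + 1 := ⟨n - 1, by omega⟩
  simp only [diff, Nat.add_sub_cancel]
  rw [Finset.sum_Icc_succ_top (by omega), Finset.sum_Icc_succ_top (by omega)]
  have : dcc a (m + 1) (m + 1) = doc a (m + 1) (m + 1) := by simp [dcc]
  rw [this, Finset.sum_congr rfl fun j hj => by rw [dcc_succ a (Finset.mem_Icc.mp hj).2]]
  simp_rw [add_mul]
  rw [Finset.sum_add_distrib]
  ring

end TFAC

namespace TFAC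

/-! ### The function `ρ` -/

section Rho

variable {β : ℝ}

theorem rpow_one_add_exponent (hβ : 0 < β) {x : ℝ} (hx : 0 ≤ x) : x ^ (1 + β) = x * x ^ β := by
  rw [Real.rpow_add' hx (by linarith), Real.rpow_one]

theorem rho_zero (hβ : 0 < β) : rho β 0 = 0 := by
  simp [rho, Real.zero_rpow (by linarith : 1 + β ≠ 0)]

theorem rho_pos (hβ : 0 < β) {z : ℝ} (hz : 0 < z) : 0 < rho β z := by
  rw [rho, rpow_one_add_exponent hβ (by linarith), rpow_one_add_exponent hβ hz.le]
  have h1 : z ^ β < (z + 1) ^ β := Real.rpow_lt_rpow hz.le (by linarith) hβ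
  have h2 : 1 < (z + 1) ^ β := Real.one_lt_rpow (by linarith) hβ
  nlinarith

/-- Subadditivity and Bernoulli's inequality bound the two parts of `ρ(z) = z ((z+1)^β - z^β) +
((z+1)^β - 1)` by `z` and `β z`. This is the comparison of the first two entries of the first
column. -/
theorem rho_lt_two_mul (hβ : 0 < β) (hβ1 : β < 1) {z : ℝ} (hz : 0 < z) : rho β z < 2 * z := by
  rw [rho, rpow_one_add_exponent hβ (by linarith), rpow_one_add_exponent hβ hz.le]
  have h1 : (z + 1) ^ β ≤ z ^ β + 1 ^ β := Real.rpow_add_le_add_rpow hz.le zero_le_one hβ.le hβ1.le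
  have h2 : (1 + z) ^ β ≤ 1 + β * z :=
    rpow_one_add_le_one_add_mul_self (by linarith) hβ.le hβ1.le
  rw [Real.one_rpow] at h1
  rw [add_comm 1 z] at h2
  nlinarith

theorem rho_concaveOn (hβ : 0 < β) (hβ1 : β < 1) : ConcaveOn ℝ (Set.Ici 0) (rho β) := by
  refine concaveOn_of_hasDerivWithinAt2_nonpos (f' := fun z => (1 + β) * ((z + 1) ^ β - z ^ β))
    (f'' := fun z => (1 + β) * (β * ((z + 1) ^ (β - 1) - z ^ (β - 1)))) (convex_Ici 0) ?_ ?_ ?_ ?_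
  · have h : 0 ≤ 1 + β := by linarith
    exact ((((Real.continuous_rpow_const h).comp (continuous_id.add continuous_const)).sub
      (Real.continuous_rpow_const h)).sub continuous_const).continuousOn
  · intro z hz
    rw [interior_Ici, Set.mem_Ioi] at hz
    have h1 : HasDerivAt (fun z : ℝ => (z + 1) ^ (1 + β)) (1 * (1 + β) * (z + 1) ^ (1 + β - 1)) z :=
      ((hasDerivAt_id z).add_const 1).rpow_const (Or.inl (by simp; linarith))
    have h2 : HasDerivAt (fun z : ℝ => z ^ (1 + β)) (1 * (1 + β) * z ^ (1 + β - 1)) z :=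
      (hasDerivAt_id z).rpow_const (Or.inl (by simp; linarith))
    refine HasDerivAt.hasDerivWithinAt (((h1.sub h2).sub_const 1).congr_deriv ?_)
    rw [add_sub_cancel_left]
    ring
  · intro z hz
    rw [interior_Ici, Set.mem_Ioi] at hz
    have h1 : HasDerivAt (fun z : ℝ => (z + 1) ^ β) (1 * β * (z + 1) ^ (β - 1)) z :=
      ((hasDerivAt_id z).add_const 1).rpow_const (Or.inl (by simp; linarith))
    have h2 : HasDerivAt (fun z : ℝ => z ^ β) (1 * β * z ^ (β - 1)) z :=
      (hasDerivAt_id z).rpow_const (Or.inl (by simp; linarith))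
    refine HasDerivAt.hasDerivWithinAt (((h1.sub h2).const_mul (1 + β)).congr_deriv ?_)
    ring
  · intro z hz
    rw [interior_Ici, Set.mem_Ioi] at hz
    have : (z + 1) ^ (β - 1) ≤ z ^ (β - 1) :=
      Real.rpow_le_rpow_of_nonpos hz (by linarith) (by linarith)
    exact mul_nonpos_of_nonneg_of_nonpos (by linarith)
      (mul_nonpos_of_nonneg_of_nonpos hβ.le (by linarith))

theorem mul_rho_le (hβ : 0 < β) (hβ1 : β < 1) {c y : ℝ} (hc : 0 ≤ c) (hc1 : c ≤ 1) (hy : 0 ≤ y) :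
    c * rho β y ≤ rho β (c * y) := by
  have := (rho_concaveOn hβ hβ1).2 (Set.mem_Ici.mpr hy) (Set.mem_Ici.mpr le_rfl) hc
    (sub_nonneg.mpr hc1) (by ring)
  simpa [rho_zero hβ] using this

/-- `(x+y)^{1+β} - x^{1+β} - y^{1+β}` is symmetric and homogeneous. Through this inversion, the
decrease of `ρ(x)/x`, due to concavity and `ρ(0) = 0`, becomes the increase of `ρ(z)/z^β`. -/
theorem rho_eq_rpow_mul_rho_inv {z : ℝ} (hz : 0 < z) :
    rho β z = z ^ (1 + β) * rho β (1 / z) := by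
  have h0 : (0 : ℝ) < 1 / z := by positivity
  have e1 : z ^ (1 + β) * (1 / z + 1) ^ (1 + β) = (z + 1) ^ (1 + β) := by
    rw [← Real.mul_rpow hz.le (by positivity)]
    congr 1
    field_simp
    ring
  have e2 : z ^ (1 + β) * (1 / z) ^ (1 + β) = 1 := by
    rw [← Real.mul_rpow hz.le h0.le, mul_one_div_cancel hz.ne', Real.one_rpow]
  rw [rho, rho, mul_sub, mul_sub, e1, e2]
  ring

/-- `ρ(z) / z^β` is increasing. -/
theorem rpow_mul_rho_le (hβ : 0 < β) (hβ1 : β < 1) {c y : ℝ} (hc : 1 ≤ c) (hy : 0 < y) :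
    c ^ β * rho β y ≤ rho β (c * y) := by
  have hc0 : 0 < c := by linarith
  rw [rho_eq_rpow_mul_rho_inv hy, rho_eq_rpow_mul_rho_inv (mul_pos hc0 hy)]
  have h := mul_rho_le hβ hβ1 (c := 1 / c) (y := 1 / y) (by positivity)
    (by rw [div_le_one hc0]; exact hc) (by positivity)
  rw [one_div_mul_one_div] at h
  have e : c ^ β * (y ^ (1 + β) * rho β (1 / y))
      = (c * y) ^ (1 + β) * (1 / c * rho β (1 / y)) := by
    rw [Real.mul_rpow hc0.le hy.le, rpow_one_add_exponent hβ hc0.le]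
    field_simp
  rw [e]
  exact mul_le_mul_of_nonneg_left h (by positivity)

theorem rho_le_of_one_le (hβ : 0 < β) (hβ1 : β < 1) {z : ℝ} (hz : 1 ≤ z) :
    rho β z ≤ 2 * ((1 + z) ^ β - 1) := by
  have hz0 : 0 < z := by linarith
  -- Hölder's inequality for the pairs `(z² - 1, 1)` and `(z - 1, 1)` with weights `β` and `1 - β`.
  -- The two weighted AM–GM bounds `A` and `B` are its normalized summands, and their right sides
  -- add up to `1`.
  have key : (z + 1) ^ β * (z - 1) + 1 ≤ z * z ^ β := by
    have A := Real.geom_mean_le_arith_mean2_weighted (w₁ := β) (w₂ := 1 - β)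
      (p₁ := (z ^ 2 - 1) / z ^ 2) (p₂ := (z - 1) / z) hβ.le (by linarith)
      (div_nonneg (by nlinarith) (by positivity)) (div_nonneg (by linarith) hz0.le) (by ring)
    have B := Real.geom_mean_le_arith_mean2_weighted (w₁ := β) (w₂ := 1 - β)
      (p₁ := 1 / z ^ 2) (p₂ := 1 / z) hβ.le (by linarith) (by positivity) (by positivity) (by ring)
    have hs : β * ((z ^ 2 - 1) / z ^ 2) + (1 - β) * ((z - 1) / z)
        + (β * (1 / z ^ 2) + (1 - β) * (1 / z)) = 1 := by field_simp; ring
    have hzb : (z ^ 2) ^ β * z ^ (1 - β) = z * z ^ β := by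
      rw [← Real.rpow_natCast, ← Real.rpow_mul hz0.le, ← Real.rpow_add hz0,
        ← rpow_one_add_exponent hβ hz0.le]
      congr 1
      push_cast
      ring
    have hA : ((z ^ 2 - 1) / z ^ 2) ^ β * ((z - 1) / z) ^ (1 - β) * (z * z ^ β)
        = (z + 1) ^ β * (z - 1) := by
      rw [← hzb, Real.div_rpow (by nlinarith) (by positivity), Real.div_rpow (by linarith) hz0.le]
      have e : (z ^ 2 - 1) ^ β * (z - 1) ^ (1 - β) = (z + 1) ^ β * (z - 1) := by
        rw [show z ^ 2 - 1 = (z + 1) * (z - 1) by ring, Real.mul_rpow (by linarith) (by linarith),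
          mul_assoc, ← Real.rpow_add' (by linarith) (by norm_num)]
        norm_num
      have h1 : 0 < (z ^ 2) ^ β := by positivity
      have h2 : 0 < z ^ (1 - β) := by positivity
      rw [← e]
      field_simp
    have hB : (1 / z ^ 2) ^ β * (1 / z) ^ (1 - β) * (z * z ^ β) = 1 := by
      rw [← hzb, Real.div_rpow (by norm_num) (by positivity), Real.div_rpow (by norm_num) hz0.le,
        Real.one_rpow, Real.one_rpow]
      have h1 : 0 < (z ^ 2) ^ β := by positivity
      have h2 : 0 < z ^ (1 - β) := by positivity
      field_simp
    have hp : 0 ≤ z * z ^ β := by positivity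
    nlinarith
  rw [rho, rpow_one_add_exponent hβ (by linarith), rpow_one_add_exponent hβ hz0.le, add_comm 1 z]
  nlinarith

/-- The inequality between `ρ` at neighbouring step ratios that the step-ratio constraint gives. -/
theorem rho_mul_rho_le (hβ : 0 < β) (hβ1 : β < 1) {y z : ℝ} (hy : 0 < y) (hz : 0 < z)
    (h : rStar β y ≤ z) :
    rho β y * rho β z ≤ 2 * (rho β (y * (1 + z)) - rho β y) := by
  have hρ := rho_pos hβ hy
  rcases le_total 1 z with hz1 | hz1
  -- For `z ≥ 1` two bounds suffice: `ρ(y(1+z)) ≥ (1+z)^β ρ(y)` and `ρ(z) ≤ 2((1+z)^β - 1)`.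
  · have h1 := rpow_mul_rho_le hβ hβ1 (c := 1 + z) (by linarith) hy
    have h2 := rho_le_of_one_le hβ hβ1 hz1
    rw [mul_comm y]
    nlinarith
  -- For `z ≤ 1` everything is compared with its value at `z = 1`: `ρ(z) ≤ z^β ρ(1)`, and `ρ(y(1+z))
  -- - ρ(y)` lies above its chord in `z`. The mismatch between `z^β` and `z` is the factor `z^{1-β}`
  -- that the constraint controls.
  · have h2 : (1 : ℝ) < 2 ^ β := Real.one_lt_rpow (by norm_num) hβ
    have h3 := rpow_mul_rho_le hβ hβ1 (c := 2) (by norm_num) hy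
    have hd : 0 < rho β (2 * y) - rho β y := by nlinarith
    have hb : 0 ≤ ((2 : ℝ) ^ β - 1) * rho β y / (rho β (2 * y) - rho β y) :=
      div_nonneg (mul_nonneg (by linarith) hρ.le) hd.le
    have h4 : ((2 : ℝ) ^ β - 1) * rho β y ≤ z ^ (1 - β) * (rho β (2 * y) - rho β y) := by
      rw [← div_le_iff₀ hd]
      have := Real.rpow_le_rpow (Real.rpow_nonneg hb _) h (by linarith : 0 ≤ 1 - β)
      rwa [← Real.rpow_mul hb, one_div_mul_cancel (by linarith), Real.rpow_one] at this
    have h5 : z * (rho β (2 * y) - rho β y) ≤ rho β (y * (1 + z)) - rho β y := by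
      have := (rho_concaveOn hβ hβ1).2 (Set.mem_Ici.mpr (by positivity : 0 ≤ 2 * y))
        (Set.mem_Ici.mpr hy.le) hz.le (sub_nonneg.mpr hz1) (by ring)
      simp only [smul_eq_mul] at this
      rw [show z * (2 * y) + (1 - z) * y = y * (1 + z) by ring] at this
      linarith
    have h6 : rho β z ≤ z ^ β * (2 * ((2 : ℝ) ^ β - 1)) := by
      have := rpow_mul_rho_le hβ hβ1 (c := 1 / z) (y := z) (by rw [le_div_iff₀ hz]; linarith) hz
      have e : rho β 1 = 2 * ((2 : ℝ) ^ β - 1) := by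
        rw [rho, rpow_one_add_exponent hβ (by norm_num), Real.one_rpow]
        norm_num
        ring
      rw [one_div_mul_cancel hz.ne', e, Real.div_rpow zero_le_one hz.le, Real.one_rpow] at this
      have hzp : 0 < z ^ β := by positivity
      rwa [one_div_mul_eq_div, div_le_iff₀' hzp] at this
    have h7 : z ^ β * z ^ (1 - β) = z := by
      rw [← Real.rpow_add hz]; norm_num
    have hzp : 0 < z ^ β := by positivity
    calc rho β y * rho β z ≤ rho β y * (z ^ β * (2 * ((2 : ℝ) ^ β - 1))) :=
          mul_le_mul_of_nonneg_left h6 hρ.le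
      _ = 2 * (z ^ β * (((2 : ℝ) ^ β - 1) * rho β y)) := by ring
      _ ≤ 2 * (z ^ β * (z ^ (1 - β) * (rho β (2 * y) - rho β y))) := by gcongr
      _ = 2 * (z * (rho β (2 * y) - rho β y)) := by rw [← mul_assoc (z ^ β), h7]
      _ ≤ _ := by linarith

end Rho

end TFAC

noncomputable section

namespace TFAC

/-! ### The averaged kernels -/

/-- The integral of `ω_β(s - r)` over `c ≤ r ≤ d`, for `d ≤ s`. -/
def omegaIntegral (β c d s : ℝ) : ℝ := ((s - c) ^ β - (s - d) ^ β) / (Real.Gamma β * β)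

variable {β : ℝ}

theorem omega_intervalIntegrable (hβ : 0 < β) (s c d : ℝ) :
    IntervalIntegrable (fun r => omega β (s - r)) volume c d := by
  have h : IntervalIntegrable (fun x : ℝ => x ^ (β - 1)) volume (s - c) (s - d) :=
    intervalIntegral.intervalIntegrable_rpow' (by linarith)
  have h' := (h.div_const (Real.Gamma β)).comp_sub_left s
  simpa [omega] using h'

theorem integral_omega (hβ : 0 < β) (s c d : ℝ) :
    ∫ r in c..d, omega β (s - r) = omegaIntegral β c d s := by
  rw [intervalIntegral.integral_comp_sub_left (fun x => omega β x) s]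
  simp only [omega]
  rw [intervalIntegral.integral_div, integral_rpow (Or.inl (by linarith)), omegaIntegral,
    sub_add_cancel, div_div, mul_comm β]

theorem continuous_omegaIntegral (hβ : 0 < β) (c d : ℝ) : Continuous (omegaIntegral β c d) := by
  have h := Real.continuous_rpow_const hβ.le
  exact ((h.comp (continuous_id.sub continuous_const)).sub
    (h.comp (continuous_id.sub continuous_const))).div_const _

theorem omega_pos (hβ : 0 < β) {x : ℝ} (hx : 0 < x) : 0 < omega β x :=
  div_pos (Real.rpow_pos_of_pos hx _) (Real.Gamma_pos_of_pos hβ)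

theorem omegaIntegral_pos (hβ : 0 < β) {c d s : ℝ} (hcd : c < d) (hs : d ≤ s) :
    0 < omegaIntegral β c d s := by
  rw [← integral_omega hβ]
  exact intervalIntegral.intervalIntegral_pos_of_pos_on (omega_intervalIntegrable hβ s c d)
    (fun r hr => omega_pos hβ (by linarith [hr.2])) hcd

theorem omegaIntegral_strictAntiOn (hβ : 0 < β) (hβ1 : β < 1) {c d : ℝ} (hcd : c < d) :
    StrictAntiOn (omegaIntegral β c d) (Set.Ici d) := by
  intro s hs s' _ hss
  rw [Set.mem_Ici] at hs
  rw [← sub_pos, ← integral_omega hβ, ← integral_omega hβ, ← intervalIntegral.integral_sub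
    (omega_intervalIntegrable hβ s c d) (omega_intervalIntegrable hβ s' c d)]
  refine intervalIntegral.intervalIntegral_pos_of_pos_on ((omega_intervalIntegrable hβ s c d).sub
    (omega_intervalIntegrable hβ s' c d)) (fun r hr => sub_pos.mpr ?_) hcd
  exact div_lt_div_of_pos_right
    (Real.rpow_lt_rpow_of_neg (by linarith [hr.2]) (by linarith) (by linarith))
    (Real.Gamma_pos_of_pos hβ)

theorem integral_mul_integral_le {a b c d : ℝ} (hab : a ≤ b) (hcd : c ≤ d) {f g h k : ℝ → ℝ}
    (hf : IntervalIntegrable f volume a b) (hg : IntervalIntegrable g volume c d)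
    (hh : IntervalIntegrable h volume a b) (hk : IntervalIntegrable k volume c d)
    (H : ∀ x ∈ Set.Ioo a b, ∀ y ∈ Set.Ioo c d, f x * g y ≤ h x * k y) :
    (∫ x in a..b, f x) * ∫ y in c..d, g y ≤ (∫ x in a..b, h x) * ∫ y in c..d, k y := by
  rw [← intervalIntegral.integral_mul_const, ← intervalIntegral.integral_mul_const]
  refine intervalIntegral.integral_mono_on_of_le_Ioo hab (hf.mul_const _) (hh.mul_const _)
    fun x hx => ?_
  rw [← intervalIntegral.integral_const_mul, ← intervalIntegral.integral_const_mul]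
  exact intervalIntegral.integral_mono_on_of_le_Ioo hcd (hg.const_mul _) (hk.const_mul _)
    fun y hy => H x hx y hy

/-- The products of arguments differ by `(s-r)(s'-r') - (s'-r)(s-r') = (r'-r)(s'-s) ≥ 0`, and the
negative power `β - 1` reverses the order. Both integrations, in `r` and then in `s`, preserve this
inequality. -/
theorem omega_mul_omega_le (hβ1 : β < 1) {r r' s s' : ℝ} (hr : r ≤ r') (hs : s ≤ s')
    (hrs : r' < s) :
    omega β (s - r) * omega β (s' - r') ≤ omega β (s' - r) * omega β (s - r') := by
  simp only [omega, div_mul_div_comm]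
  refine div_le_div_of_nonneg_right ?_ (mul_self_nonneg _)
  rw [← Real.mul_rpow (by linarith) (by linarith), ← Real.mul_rpow (by linarith) (by linarith)]
  refine Real.rpow_le_rpow_of_nonpos (mul_pos (by linarith) (by linarith)) ?_ (by linarith)
  nlinarith [mul_nonneg (sub_nonneg.mpr hr) (sub_nonneg.mpr hs)]

theorem omegaIntegral_mul_le (hβ : 0 < β) (hβ1 : β < 1) {c d e s s' : ℝ} (hcd : c ≤ d)
    (hde : d ≤ e) (hes : e ≤ s) (hs : s ≤ s') :
    omegaIntegral β c d s * omegaIntegral β d e s'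
      ≤ omegaIntegral β c d s' * omegaIntegral β d e s := by
  simp only [← integral_omega hβ]
  exact integral_mul_integral_le hcd hde (omega_intervalIntegrable hβ s c d)
    (omega_intervalIntegrable hβ s' d e) (omega_intervalIntegrable hβ s' c d)
    (omega_intervalIntegrable hβ s d e) fun r hr r' hr' =>
      omega_mul_omega_le hβ1 (hr.2.le.trans hr'.1.le) hs (hr'.2.trans_le hes)

theorem integral_omegaIntegral_mul_le (hβ : 0 < β) (hβ1 : β < 1) {a b b' c d e : ℝ} (hcd : c ≤ d)
    (hde : d ≤ e) (hea : e ≤ a) (hab : a ≤ b) (hbb : b ≤ b') :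
    (∫ s in a..b, omegaIntegral β c d s) * (∫ s in b..b', omegaIntegral β d e s)
      ≤ (∫ s in b..b', omegaIntegral β c d s) * ∫ s in a..b, omegaIntegral β d e s := by
  rw [mul_comm (∫ s in b..b', omegaIntegral β c d s)]
  have hc := fun c d u v => (continuous_omegaIntegral hβ c d).intervalIntegrable (μ := volume) u v
  refine integral_mul_integral_le hab hbb (hc _ _ _ _) (hc _ _ _ _) (hc _ _ _ _) (hc _ _ _ _)
    fun s hs s' hs' => ?_
  rw [mul_comm (omegaIntegral β d e s)]
  exact omegaIntegral_mul_le hβ hβ1 hcd hde (hea.trans hs.1.le) (hs.2.le.trans hs'.1.le)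

theorem integral_omegaIntegral (hβ : 0 < β) (a b c d : ℝ) :
    ∫ s in a..b, omegaIntegral β c d s = ((b - c) ^ (1 + β) - (a - c) ^ (1 + β)
      - (b - d) ^ (1 + β) + (a - d) ^ (1 + β)) / (Real.Gamma β * β * (1 + β)) := by
  have h := Real.continuous_rpow_const hβ.le
  have hi : ∀ c, IntervalIntegrable (fun s : ℝ => (s - c) ^ β) volume a b := fun c =>
    (h.comp (continuous_id.sub continuous_const)).intervalIntegrable _ _
  simp only [omegaIntegral]
  rw [intervalIntegral.integral_div, intervalIntegral.integral_sub (hi c) (hi d),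
    intervalIntegral.integral_comp_sub_right (fun x => x ^ β),
    intervalIntegral.integral_comp_sub_right (fun x => x ^ β),
    integral_rpow (Or.inl (by linarith)), integral_rpow (Or.inl (by linarith)), add_comm β 1,
    ← sub_div, div_div, mul_comm (1 + β)]
  congr 1
  ring

/-- The means of a strictly decreasing function over adjacent intervals decrease. -/
theorem mean_lt_mean_of_strictAntiOn {f : ℝ → ℝ} (hc : Continuous f) {a b b' : ℝ} (hab : a < b)
    (hbb : b < b') (hf : StrictAntiOn f (Set.Ici a)) :
    (∫ s in b..b', f s) / (b' - b) < (∫ s in a..b, f s) / (b - a) := by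
  have h1 : (∫ s in b..b', f s) < f b * (b' - b) := by
    have := intervalIntegral.intervalIntegral_pos_of_pos_on (f := fun s => f b - f s)
      ((continuous_const.sub hc).intervalIntegrable _ _)
      (fun s hs => sub_pos.mpr (hf hab.le (hab.le.trans hs.1.le) hs.1)) hbb
    rw [intervalIntegral.integral_sub (continuous_const.intervalIntegrable _ _)
      (hc.intervalIntegrable _ _), intervalIntegral.integral_const, smul_eq_mul] at this
    linarith
  have h2 : f b * (b - a) < ∫ s in a..b, f s := by
    have := intervalIntegral.intervalIntegral_pos_of_pos_on (f := fun s => f s - f b)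
      ((hc.sub continuous_const).intervalIntegrable _ _)
      (fun s hs => sub_pos.mpr (hf hs.1.le hab.le hs.2)) hab
    rw [intervalIntegral.integral_sub (hc.intervalIntegrable _ _)
      (continuous_const.intervalIntegrable _ _), intervalIntegral.integral_const,
      smul_eq_mul] at this
    linarith
  exact ((div_lt_iff₀ (sub_pos.mpr hbb)).mpr h1).trans ((lt_div_iff₀ (sub_pos.mpr hab)).mpr h2)

/-! ### The modified kernels on a mesh -/

section Mesh

variable {t : ℕ → ℝ} {N : ℕ}

theorem mesh_mono (ht : ∀ k, 1 ≤ k → k ≤ N → t (k - 1) < t k) {i j : ℕ} (hij : i ≤ j)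
    (hj : j ≤ N) : t i ≤ t j := by
  induction j, hij using Nat.le_induction with
  | base => exact le_rfl
  | succ j h ih => exact (ih (by omega)).trans (ht (j + 1) (by omega) hj).le

theorem step_pos (ht : ∀ k, 1 ≤ k → k ≤ N → t (k - 1) < t k) {k : ℕ} (hk : 1 ≤ k) (hkN : k ≤ N) :
    0 < step t k := sub_pos.mpr (ht k hk hkN)

theorem modKernel_of_lt (hβ : 0 < β) (ht : ∀ k, 1 ≤ k → k ≤ N → t (k - 1) < t k) {n k : ℕ}
    (hkn : k < n) (hn : n ≤ N) :
    modKernel β t n k = 1 / (step t n * step t k) *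
      ∫ s in (t (n - 1))..(t n), omegaIntegral β (t (k - 1)) (t k) s := by
  rw [modKernel, if_neg hkn.ne, kernel]
  congr 1
  refine intervalIntegral.integral_congr fun s hs => ?_
  rw [Set.uIcc_of_le (ht n (by omega) hn).le] at hs
  have : t k ≤ s := (mesh_mono ht (by omega) (by omega)).trans hs.1
  simp only [min_eq_right this]
  exact integral_omega hβ _ _ _

theorem modKernel_self (hβ : 0 < β) (ht : ∀ k, 1 ≤ k → k ≤ N → t (k - 1) < t k) {n : ℕ}
    (hn1 : 1 ≤ n) (hn : n ≤ N) :
    modKernel β t n n = 1 / (step t n * step t n) *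
      (2 * step t n ^ (1 + β) / (Real.Gamma β * β * (1 + β))) := by
  have : ∫ s in (t (n - 1))..(t n), ∫ r in (t (n - 1))..(min s (t n)), omega β (s - r)
      = step t n ^ (1 + β) / (Real.Gamma β * β * (1 + β)) := by
    have h : ∫ s in (t (n - 1))..(t n), ∫ r in (t (n - 1))..(min s (t n)), omega β (s - r)
        = ∫ s in (t (n - 1))..(t n), (s - t (n - 1)) ^ β / (Real.Gamma β * β) := by
      refine intervalIntegral.integral_congr fun s hs => ?_
      rw [Set.uIcc_of_le (ht n hn1 hn).le] at hs
      simp only [min_eq_left hs.2]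
      rw [integral_omega hβ, omegaIntegral, sub_self, Real.zero_rpow hβ.ne', sub_zero]
    rw [h, intervalIntegral.integral_div,
      intervalIntegral.integral_comp_sub_right (fun x => x ^ β),
      integral_rpow (Or.inl (by linarith)), sub_self, Real.zero_rpow (by linarith), sub_zero,
      add_comm β 1, div_div, mul_comm (1 + β)]
    rfl
  rw [modKernel, if_pos rfl, kernel, this]
  ring

theorem modKernel_pos (hβ : 0 < β) (ht : ∀ k, 1 ≤ k → k ≤ N → t (k - 1) < t k) {n k : ℕ}
    (hk : 1 ≤ k) (hkn : k ≤ n) (hn : n ≤ N) : 0 < modKernel β t n k := by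
  have h1 := step_pos ht hk (hkn.trans hn)
  have h2 := step_pos ht (hk.trans hkn) hn
  have h3 := Real.Gamma_pos_of_pos hβ
  rcases eq_or_lt_of_le hkn with rfl | hlt
  · rw [modKernel_self hβ ht hk hn]
    positivity
  · rw [modKernel_of_lt hβ ht hlt hn]
    refine mul_pos (by positivity) (intervalIntegral.intervalIntegral_pos_of_pos_on
      ((continuous_omegaIntegral hβ _ _).intervalIntegrable _ _) (fun s hs =>
        omegaIntegral_pos hβ (ht k hk (hkn.trans hn)) ?_) (ht n (hk.trans hkn) hn))
    exact (mesh_mono ht (by omega) (by omega)).trans hs.1.le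

/-! ### Kernel entries near the diagonal and sign conditions -/

theorem add_rpow_sub_eq_mul_rho {x y : ℝ} (hx : 0 < x) (hy : 0 < y) :
    (x + y) ^ (1 + β) - x ^ (1 + β) - y ^ (1 + β) = x ^ (1 + β) * rho β (y / x) := by
  have e1 : x ^ (1 + β) * (y / x + 1) ^ (1 + β) = (x + y) ^ (1 + β) := by
    rw [← Real.mul_rpow hx.le (by positivity)]
    congr 1
    field_simp
    ring
  have e2 : x ^ (1 + β) * (y / x) ^ (1 + β) = y ^ (1 + β) := by
    rw [← Real.mul_rpow hx.le (by positivity), mul_div_cancel₀ _ hx.ne']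
  rw [rho, mul_sub, mul_sub, e1, e2]
  ring

theorem modKernel_succ (hβ : 0 < β) (ht : ∀ k, 1 ≤ k → k ≤ N → t (k - 1) < t k) {k : ℕ}
    (hk : 1 ≤ k) (hn : k + 1 ≤ N) :
    modKernel β t (k + 1) k = 1 / (step t (k + 1) * step t k) *
      (step t k ^ (1 + β) * rho β (ratio t (k + 1)) / (Real.Gamma β * β * (1 + β))) := by
  have h1 := step_pos ht hk (by omega)
  have h2 := step_pos ht (k := k + 1) (by omega) hn
  rw [modKernel_of_lt hβ ht (by omega : k < k + 1) hn, integral_omegaIntegral hβ, ratio,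
    Nat.add_sub_cancel, ← add_rpow_sub_eq_mul_rho h1 h2]
  simp only [step, Nat.add_sub_cancel, sub_self]
  rw [Real.zero_rpow (by linarith)]
  congr 2
  rw [show t k - t (k - 1) + (t (k + 1) - t k) = t (k + 1) - t (k - 1) by ring]
  ring

theorem modKernel_add_two (hβ : 0 < β) (ht : ∀ k, 1 ≤ k → k ≤ N → t (k - 1) < t k) {k : ℕ}
    (hk : 1 ≤ k) (hn : k + 2 ≤ N) :
    modKernel β t (k + 2) k = 1 / (step t (k + 2) * step t k) *
      (step t k ^ (1 + β) * (rho β (ratio t (k + 1) * (1 + ratio t (k + 2)))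
        - rho β (ratio t (k + 1))) / (Real.Gamma β * β * (1 + β))) := by
  have h1 := step_pos ht hk (by omega)
  have h2 := step_pos ht (k := k + 1) (by omega) (by omega)
  have h3 := step_pos ht (k := k + 2) (by omega) hn
  have e : ratio t (k + 1) * (1 + ratio t (k + 2))
      = (step t (k + 1) + step t (k + 2)) / step t k := by
    simp only [ratio, Nat.add_sub_cancel, Nat.add_succ_sub_one]
    field_simp
  rw [modKernel_of_lt hβ ht (by omega) hn, integral_omegaIntegral hβ, e, mul_sub, ratio,
    Nat.add_sub_cancel, ← add_rpow_sub_eq_mul_rho h1 h2,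
    ← add_rpow_sub_eq_mul_rho h1 (by positivity)]
  simp only [step, Nat.add_sub_cancel, Nat.add_succ_sub_one]
  congr 2
  rw [show t k - t (k - 1) + (t (k + 1) - t k + (t (k + 2) - t (k + 1))) = t (k + 2) - t (k - 1)
      by ring, show t k - t (k - 1) + (t (k + 1) - t k) = t (k + 1) - t (k - 1) by ring,
    show t (k + 1) - t k + (t (k + 2) - t (k + 1)) = t (k + 2) - t k by ring]
  ring

/-- Consecutive `2 × 2` minors of the modified kernel matrix off the diagonal. -/
theorem modKernel_mul_le (hβ : 0 < β) (hβ1 : β < 1)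
    (ht : ∀ k, 1 ≤ k → k ≤ N → t (k - 1) < t k) (hr : StepRatioConstraint β t N) {j k : ℕ}
    (hk : 1 ≤ k) (hkj : k + 1 ≤ j) (hj : j + 1 ≤ N) :
    modKernel β t j k * modKernel β t (j + 1) (k + 1)
      ≤ modKernel β t (j + 1) k * modKernel β t j (k + 1) := by
  have hsj := step_pos ht (k := j) (by omega) (by omega)
  have hsj1 := step_pos ht (k := j + 1) (by omega) (by omega)
  have hsk := step_pos ht hk (by omega)
  have hsk1 := step_pos ht (k := k + 1) (by omega) (by omega)
  have hG := Real.Gamma_pos_of_pos hβ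
  rcases eq_or_lt_of_le hkj with rfl | hlt
  -- This minor contains the diagonal entry of row `k + 1`. After the common factor `c` is removed,
  -- the doubling supplies the `2` in `rho_mul_rho_le`.
  · rw [modKernel_succ hβ ht hk (by omega), modKernel_succ hβ ht (by omega) (by omega),
      modKernel_add_two hβ ht hk (by omega), modKernel_self hβ ht (by omega) (by omega)]
    have hy : 0 < ratio t (k + 1) := div_pos hsk1 hsk
    have hz : 0 < ratio t (k + 2) := div_pos hsj1 hsk1
    have := rho_mul_rho_le hβ hβ1 hy hz (hr (k + 1) (by omega) (by omega))
    set D := Real.Gamma β * β * (1 + β)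
    have hD : 0 < D := by positivity
    set c := 1 / (step t (k + 1) * step t k) * (1 / (step t (k + 1 + 1) * step t (k + 1))) *
      (step t k ^ (1 + β) * step t (k + 1) ^ (1 + β)) / D ^ 2 with hcdef
    have hc : 0 ≤ c := by positivity
    calc _ = c * (rho β (ratio t (k + 1)) * rho β (ratio t (k + 2))) := by
          rw [hcdef]; field_simp
      _ ≤ c * (2 * (rho β (ratio t (k + 1) * (1 + ratio t (k + 2))) - rho β (ratio t (k + 1)))) :=
          mul_le_mul_of_nonneg_left this hc
      _ = _ := by rw [hcdef]; field_simp
  · rw [modKernel_of_lt hβ ht (by omega : k < j) (by omega),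
      modKernel_of_lt hβ ht (by omega : k + 1 < j + 1) (by omega),
      modKernel_of_lt hβ ht (by omega : k < j + 1) (by omega),
      modKernel_of_lt hβ ht (by omega : k + 1 < j) (by omega)]
    simp only [Nat.add_sub_cancel]
    have := integral_omegaIntegral_mul_le hβ hβ1 (ht k hk (by omega)).le
      (ht (k + 1) (by omega) (by omega)).le
      (mesh_mono ht (by omega : k + 1 ≤ j - 1) (by omega)) (ht j (by omega) (by omega)).le
      (ht (j + 1) (by omega) (by omega)).le
    set c := 1 / (step t j * step t k) * (1 / (step t (j + 1) * step t (k + 1))) with hcdef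
    have hc : 0 ≤ c := by positivity
    have h := mul_le_mul_of_nonneg_left this hc
    have e : 1 / (step t (j + 1) * step t k) * (1 / (step t j * step t (k + 1))) = c := by
      rw [hcdef]; field_simp
    refine (le_of_eq ?_).trans (h.trans (le_of_eq ?_))
    · rw [hcdef]; ring
    · rw [← e]; ring

/-- The inequalities for consecutive rows chain together once they are written as quotients of
positive entries. -/
theorem modKernel_quotient_le (hβ : 0 < β) (hβ1 : β < 1)
    (ht : ∀ k, 1 ≤ k → k ≤ N → t (k - 1) < t k) (hr : StepRatioConstraint β t N) {j k n : ℕ}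
    (hk : 1 ≤ k) (hkj : k + 1 ≤ j) (hjn : j ≤ n) (hn : n ≤ N) :
    modKernel β t j k * modKernel β t n (k + 1)
      ≤ modKernel β t n k * modKernel β t j (k + 1) := by
  have hp : ∀ m, k + 1 ≤ m → m ≤ N → 0 < modKernel β t m (k + 1) := fun m h h' =>
    modKernel_pos hβ ht (by omega) h h'
  rw [← div_le_div_iff₀ (hp j hkj (by omega)) (hp n (by omega) hn)]
  induction n, hjn using Nat.le_induction with
  | base => exact le_rfl
  | succ n h ih =>
    refine (ih (by omega)).trans ?_
    rw [div_le_div_iff₀ (hp n (by omega) (by omega)) (hp (n + 1) (by omega) hn)]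
    exact modKernel_mul_le hβ hβ1 ht hr hk (by omega) hn

/-- From the second row on, the entries are, up to the factor `1 / τ_1`, means over successive steps
of one strictly decreasing function of `s`. The doubled first entry is handled by `ρ(r) < 2r`. -/
theorem modKernel_first_column_lt (hβ : 0 < β) (hβ1 : β < 1)
    (ht : ∀ k, 1 ≤ k → k ≤ N → t (k - 1) < t k) {j : ℕ} (hj : 1 ≤ j) (hjN : j + 1 ≤ N) :
    modKernel β t (j + 1) 1 < modKernel β t j 1 := by
  have hs1 := step_pos ht (k := 1) le_rfl (by omega)
  have hsj1 := step_pos ht (k := j + 1) (by omega) (by omega)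
  have hsj := step_pos ht (k := j) (by omega) (by omega)
  have hG := Real.Gamma_pos_of_pos hβ
  rcases eq_or_lt_of_le hj with rfl | hlt
  · rw [modKernel_succ hβ ht le_rfl hjN, modKernel_self hβ ht le_rfl (by omega)]
    have h := rho_lt_two_mul hβ hβ1 (div_pos hsj1 hs1)
    have e : ratio t (1 + 1) = step t (1 + 1) / step t 1 := rfl
    rw [← e] at h
    set D := Real.Gamma β * β * (1 + β)
    have hD : 0 < D := by positivity
    set c := 1 / (step t (1 + 1) * step t 1) * step t 1 ^ (1 + β) / D with hcdef
    have hc : 0 < c := by positivity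
    calc _ = c * rho β (ratio t (1 + 1)) := by rw [hcdef]; field_simp
      _ < c * (2 * ratio t (1 + 1)) := mul_lt_mul_of_pos_left h hc
      _ = _ := by rw [hcdef, e]; field_simp
  · rw [modKernel_of_lt hβ ht (by omega) hjN, modKernel_of_lt hβ ht hlt (by omega)]
    have hm : t 1 ≤ t (j - 1) := mesh_mono ht (by omega) (by omega)
    have h := mean_lt_mean_of_strictAntiOn (continuous_omegaIntegral hβ (t (1 - 1)) (t 1))
      (ht j hj (by omega)) (ht (j + 1) (by omega) hjN)
      ((omegaIntegral_strictAntiOn hβ hβ1 (ht 1 le_rfl (by omega))).mono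
        (Set.Ici_subset_Ici.mpr hm))
    have h' := div_lt_div_of_pos_right h hs1
    change _ / step t (j + 1) / _ < _ / step t j / _ at h'
    rw [div_div, div_div] at h'
    rw [one_div_mul_eq_div, one_div_mul_eq_div]
    exact h'

theorem doc_modKernel_nonpos (hβ : 0 < β) (hβ1 : β < 1)
    (ht : ∀ k, 1 ≤ k → k ≤ N → t (k - 1) < t k) (hr : StepRatioConstraint β t N) {n : ℕ}
    (hn : n ≤ N) (k : ℕ) (hk : 1 ≤ k) (hkn : k < n) : doc (modKernel β t) n k ≤ 0 :=
  doc_nonpos (fun _ _ h1 h2 h3 => modKernel_pos hβ ht h1 h2 (h3.trans hn))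
    (fun _ _ h1 h2 h3 => modKernel_quotient_le hβ hβ1 ht hr h1 h2 h3 hn) k hk hkn

theorem rcc_modKernel_pos (hβ : 0 < β) (hβ1 : β < 1)
    (ht : ∀ k, 1 ≤ k → k ≤ N → t (k - 1) < t k) (hr : StepRatioConstraint β t N) {n : ℕ}
    (hn : n ≤ N) (k : ℕ) (hk : 1 ≤ k) (hkn : k ≤ n) : 0 < rcc (modKernel β t) n k :=
  rcc_pos (fun _ _ h1 h2 h3 => modKernel_pos hβ ht h1 h2 (h3.trans hn))
    (doc_modKernel_nonpos hβ hβ1 ht hr hn)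
    (fun _ h1 h2 => modKernel_first_column_lt hβ hβ1 ht h1 (h2.trans hn)) k hk hkn

end Mesh

end TFAC

end

namespace TFAC

/-! ### Testing the scheme with functions of the energy space -/

section Energy

variable {L : Fin 2 → ℝ}

instance isFiniteMeasure_vol (L : Fin 2 → ℝ) : IsFiniteMeasure (vol L) := by
  refine ⟨?_⟩
  rw [vol, Measure.restrict_apply_univ, cell, volume_pi_pi]
  exact ENNReal.prod_lt_top fun i _ => by rw [Real.volume_Ioo]; exact ENNReal.ofReal_lt_top

theorem holderTriple_four_four_two : ENNReal.HolderTriple 4 4 2 := by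
  constructor
  rw [← ENNReal.toReal_eq_toReal_iff' (by simp) (by simp),
    ENNReal.toReal_add (by simp) (by simp)]
  simp only [ENNReal.toReal_inv, ENNReal.toReal_ofNat]
  norm_num

theorem holderTriple_two_four : ENNReal.HolderTriple 2 4 (4 / 3) := by
  have h3 : (4 / 3 : ENNReal)⁻¹ ≠ ⊤ := by
    rw [ENNReal.inv_ne_top]; exact (ENNReal.div_pos (by simp) (by simp)).ne'
  constructor
  rw [← ENNReal.toReal_eq_toReal_iff' (by simp) h3, ENNReal.toReal_add (by simp) (by simp)]
  simp only [ENNReal.toReal_inv, ENNReal.toReal_div, ENNReal.toReal_ofNat]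
  norm_num

theorem holderTriple_fourThirds_four : ENNReal.HolderTriple (4 / 3) 4 1 := by
  have h3 : (4 / 3 : ENNReal)⁻¹ ≠ ⊤ := by
    rw [ENNReal.inv_ne_top]; exact (ENNReal.div_pos (by simp) (by simp)).ne'
  constructor
  rw [← ENNReal.toReal_eq_toReal_iff' (by simp [h3]) (by simp), ENNReal.toReal_add h3 (by simp)]
  simp only [ENNReal.toReal_inv, ENNReal.toReal_div, ENNReal.toReal_ofNat, ENNReal.toReal_one]
  norm_num

theorem fourThirds_le_four : (4 / 3 : ENNReal) ≤ 4 :=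
  ENNReal.div_le_of_le_mul (by norm_num)

/-- Integration against a fixed function of `L^p` is continuous on the conjugate space `L^q`. -/
theorem tendsto_integral_mul {X : Type*} [MeasurableSpace X] {μ : Measure X} {p q : ENNReal}
    [ENNReal.HolderTriple p q 1] {F u : X → ℝ} {ψ : ℕ → X → ℝ} (hF : MemLp F p μ)
    (hu : MemLp u q μ) (hψ : ∀ m, AEStronglyMeasurable (ψ m) μ)
    (h : Tendsto (fun m => eLpNorm (ψ m - u) q μ) atTop (𝓝 0)) :
    Tendsto (fun m => ∫ x, F x * ψ m x ∂μ) atTop (𝓝 (∫ x, F x * u x ∂μ)) := by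
  have hmem : ∀ᶠ m in atTop, MemLp (ψ m - u) q μ := by
    filter_upwards [h.eventually (gt_mem_nhds (show (0 : ENNReal) < 1 by simp))] with m hm
    exact ⟨(hψ m).sub hu.1, hm.trans ENNReal.one_lt_top⟩
  refine tendsto_integral_of_L1' (fun x => F x * u x) (hF.1.mul hu.1) ?_ ?_
  · filter_upwards [hmem] with m hm
    have : MemLp (ψ m) q μ := by simpa using hm.add hu
    exact hF.integrable_mul this
  · have hb : Tendsto (fun m => eLpNorm F p μ * eLpNorm (ψ m - u) q μ) atTop (𝓝 0) := by
      simpa using ENNReal.Tendsto.const_mul h (Or.inr hF.2.ne)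
    refine tendsto_of_tendsto_of_tendsto_of_le_of_le tendsto_const_nhds hb (fun _ => zero_le)
      fun m => ?_
    have := eLpNorm_smul_le_mul_eLpNorm (p := p) (q := q) (r := 1) ((hψ m).sub hu.1) hF.1
    rw [smul_eq_mul, mul_sub] at this
    exact this

theorem IsSmoothPeriodic.sub {ψ χ : (Fin 2 → ℝ) → ℝ} (hψ : IsSmoothPeriodic L ψ)
    (hχ : IsSmoothPeriodic L χ) : IsSmoothPeriodic L (ψ - χ) :=
  ⟨hψ.1.sub hχ.1, fun x i => by simp [hψ.2 x i, hχ.2 x i]⟩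

theorem IsSmoothPeriodic.pderiv_sub {ψ χ : (Fin 2 → ℝ) → ℝ} (hψ : IsSmoothPeriodic L ψ)
    (hχ : IsSmoothPeriodic L χ) (i : Fin 2) :
    pderiv i (ψ - χ) = pderiv i ψ - pderiv i χ := by
  ext x
  simp only [pderiv, Pi.sub_apply]
  rw [fderiv_sub (hψ.1.differentiable (by simp) x) (hχ.1.differentiable (by simp) x)]
  rfl

theorem IsSmoothPeriodic.continuous_pderiv {ψ : (Fin 2 → ℝ) → ℝ} (hψ : IsSmoothPeriodic L ψ)
    (i : Fin 2) : Continuous (pderiv i ψ) :=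
  (hψ.1.continuous_fderiv (by simp)).clm_apply continuous_const

theorem tendsto_eLpNorm_sub_sub {X : Type*} [MeasurableSpace X] {μ : Measure X} {q : ENNReal}
    (hq : 1 ≤ q) {u v : X → ℝ} {ψ χ : ℕ → X → ℝ}
    (hψ : ∀ m, AEStronglyMeasurable (ψ m - u) μ) (hχ : ∀ m, AEStronglyMeasurable (χ m - v) μ)
    (hu : Tendsto (fun m => eLpNorm (ψ m - u) q μ) atTop (𝓝 0))
    (hv : Tendsto (fun m => eLpNorm (χ m - v) q μ) atTop (𝓝 0)) :
    Tendsto (fun m => eLpNorm (ψ m - χ m - (u - v)) q μ) atTop (𝓝 0) := by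
  have hb := hu.add hv
  rw [add_zero] at hb
  refine tendsto_of_tendsto_of_tendsto_of_le_of_le tendsto_const_nhds hb (fun _ => zero_le)
    fun m => ?_
  have : ψ m - χ m - (u - v) = (ψ m - u) - (χ m - v) := by ring
  rw [this]
  exact eLpNorm_sub_le (hψ m) (hχ m) hq

theorem HasPeriodicGrad.sub {u v : (Fin 2 → ℝ) → ℝ} {g h : Fin 2 → (Fin 2 → ℝ) → ℝ}
    (hu : HasPeriodicGrad L u g) (hv : HasPeriodicGrad L v h) :
    HasPeriodicGrad L (u - v) (g - h) := by
  obtain ⟨hu4, hg2, ψ, hψ, hψu, hψg⟩ := hu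
  obtain ⟨hv4, hh2, χ, hχ, hχv, hχh⟩ := hv
  refine ⟨hu4.sub hv4, fun i => (hg2 i).sub (hh2 i), fun m => ψ m - χ m,
    fun m => (hψ m).sub (hχ m), ?_, fun i => ?_⟩
  · exact tendsto_eLpNorm_sub_sub (by norm_num)
      (fun m => (hψ m).1.continuous.aestronglyMeasurable.sub hu4.1)
      (fun m => (hχ m).1.continuous.aestronglyMeasurable.sub hv4.1) hψu hχv
  · simp_rw [fun m => (hψ m).pderiv_sub (hχ m) i]
    exact tendsto_eLpNorm_sub_sub (by norm_num)
      (fun m => ((hψ m).continuous_pderiv i).aestronglyMeasurable.sub (hg2 i).1)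
      (fun m => ((hχ m).continuous_pderiv i).aestronglyMeasurable.sub (hh2 i).1) (hψg i) (hχh i)

variable {α κ ε : ℝ} {t : ℕ → ℝ} {N : ℕ} {φ : ℕ → (Fin 2 → ℝ) → ℝ}
  {g : ℕ → Fin 2 → (Fin 2 → ℝ) → ℝ}

theorem IsCNSolution.memLp_diff (hφ : IsCNSolution L α κ ε t N φ g) {n : ℕ} (hn : n ≤ N) :
    MemLp (diff φ n) 4 (vol L) :=
  (hφ.hasGrad n hn).1.sub (hφ.hasGrad (n - 1) (by omega)).1

theorem IsCNSolution.memLp_caputo (hφ : IsCNSolution L α κ ε t N φ g) {n : ℕ} (hn : n ≤ N) :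
    MemLp (caputo α t φ n) 4 (vol L) :=
  memLp_finsetSum' _ fun _ hk =>
    (hφ.memLp_diff ((Finset.mem_Icc.mp hk).2.trans hn)).const_smul _

theorem IsCNSolution.memLp_vSeq (hφ : IsCNSolution L α κ ε t N φ g) {n : ℕ} (hn : n ≤ N) :
    MemLp (vSeq α t φ n) 4 (vol L) :=
  memLp_finsetSum' _ fun _ hk =>
    (hφ.memLp_diff ((Finset.mem_Icc.mp hk).2.trans hn)).const_smul _

theorem IsCNSolution.memLp_mid (hφ : IsCNSolution L α κ ε t N φ g) {n : ℕ} (hn : n ≤ N) :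
    MemLp (mid φ n) 4 (vol L) :=
  ((hφ.hasGrad n hn).1.add (hφ.hasGrad (n - 1) (by omega)).1).const_smul _

theorem IsCNSolution.memLp_mid_grad (hφ : IsCNSolution L α κ ε t N φ g) {n : ℕ} (hn : n ≤ N)
    (i : Fin 2) : MemLp (mid g n i) 2 (vol L) :=
  (((hφ.hasGrad n hn).2.1 i).add ((hφ.hasGrad (n - 1) (by omega)).2.1 i)).const_smul (2⁻¹ : ℝ)

/-- The cubic term is a product of an `L²` and an `L⁴` function, hence in `L^{4/3}`, the dual of the
space `L⁴` in which test functions converge. -/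
theorem IsCNSolution.memLp_fMid (hφ : IsCNSolution L α κ ε t N φ g) {n : ℕ} (hn : n ≤ N) :
    MemLp (fMid φ n) (4 / 3) (vol L) := by
  have := holderTriple_four_four_two
  have := holderTriple_two_four
  have h1 := (hφ.hasGrad n hn).1
  have h2 := (hφ.hasGrad (n - 1) (by omega)).1
  have hm := hφ.memLp_mid hn
  have hsq : MemLp ((1 / 2 : ℝ) • (φ n * φ n + φ (n - 1) * φ (n - 1))) 2 (vol L) :=
    ((h1.mul h1).add (h2.mul h2)).const_smul _
  have := (hm.mul hsq (r := 4 / 3)).sub (hm.mono_exponent fourThirds_le_four)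
  convert this using 1
  ext x
  simp only [fMid, Pi.sub_apply, Pi.mul_apply, Pi.smul_apply, Pi.add_apply, smul_eq_mul, sq]

/-- The scheme may be tested with every function of the periodic energy space. -/
theorem IsCNSolution.scheme_of_hasPeriodicGrad (hφ : IsCNSolution L α κ ε t N φ g) {n : ℕ}
    (hn1 : 1 ≤ n) (hn : n ≤ N) {u : (Fin 2 → ℝ) → ℝ} {h : Fin 2 → (Fin 2 → ℝ) → ℝ}
    (hu : HasPeriodicGrad L u h) :
    ∫ x, caputo α t φ n x * u x ∂(vol L) = -κ * ((∫ x, fMid φ n x * u x ∂(vol L)) +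
      ε ^ 2 * ∑ i, ∫ x, mid g n i x * h i x ∂(vol L)) := by
  have := holderTriple_fourThirds_four
  obtain ⟨hu4, hh2, ψ, hψ, hψu, hψh⟩ := hu
  have hψm := fun m => (hψ m).1.continuous.aestronglyMeasurable (μ := vol L)
  have l1 := tendsto_integral_mul ((hφ.memLp_caputo hn).mono_exponent fourThirds_le_four) hu4
    hψm hψu
  have l2 := tendsto_integral_mul (hφ.memLp_fMid hn) hu4 hψm hψu
  have l3 := fun i => tendsto_integral_mul (hφ.memLp_mid_grad hn i) (hh2 i)
    (fun m => ((hψ m).continuous_pderiv i).aestronglyMeasurable) (hψh i)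
  have l4 := (l2.add ((tendsto_finsetSum Finset.univ fun i _ => l3 i).const_mul (ε ^ 2))).const_mul
    (-κ)
  refine tendsto_nhds_unique (l1.congr' ?_) l4
  -- Integrability is needed to split the integral of the sum over `i`. Convergence to `h i` makes
  -- the gradients `L²` for all large `m`, which is enough for the limit.
  have hmem : ∀ i, ∀ᶠ m in atTop, MemLp (pderiv i (ψ m)) 2 (vol L) := fun i => by
    filter_upwards [(hψh i).eventually (gt_mem_nhds (show (0 : ENNReal) < 1 by simp))] with m hm
    have : MemLp (pderiv i (ψ m) - h i) 2 (vol L) :=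
      ⟨((hψ m).continuous_pderiv i).aestronglyMeasurable.sub (hh2 i).1,
        hm.trans ENNReal.one_lt_top⟩
    simpa using this.add (hh2 i)
  filter_upwards [eventually_all.mpr hmem] with m hm
  rw [hφ.scheme n hn1 hn (ψ m) (hψ m), muPairing, integral_finsetSum]
  exact fun i _ => (hφ.memLp_mid_grad hn i).integrable_mul (hm i)

theorem integrable_energy_density {u : (Fin 2 → ℝ) → ℝ} {h : Fin 2 → (Fin 2 → ℝ) → ℝ}
    (hu : HasPeriodicGrad L u h) : Integrable
      (fun x => ε ^ 2 / 2 * ∑ i, h i x ^ 2 + 1 / 4 * (u x ^ 2 - 1) ^ 2) (vol L) := by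
  have := holderTriple_four_four_two
  have h1 : MemLp (u * u - fun _ => 1) 2 (vol L) := (hu.1.mul hu.1).sub (memLp_const 1)
  have h2 : Integrable (fun x => (u x ^ 2 - 1) ^ 2) (vol L) := by
    simpa [sq] using h1.integrable_sq
  exact ((integrable_finsetSum _ fun i _ => (hu.2.1 i).integrable_sq).const_mul _).add
    (h2.const_mul _)

/-- The increment of the Ginzburg–Landau energy is the pairing of `μ^{n-1/2}` with the increment
of the solution. -/
theorem IsCNSolution.energy_sub (hφ : IsCNSolution L α κ ε t N φ g) {n : ℕ} (hn : n ≤ N) :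
    energy L ε (φ n) (g n) - energy L ε (φ (n - 1)) (g (n - 1))
      = (∫ x, fMid φ n x * diff φ n x ∂(vol L)) +
        ε ^ 2 * ∑ i, ∫ x, mid g n i x * diff g n i x ∂(vol L) := by
  have := holderTriple_fourThirds_four
  have hn1 : n - 1 ≤ N := by omega
  have hi : ∀ i, Integrable (fun x => mid g n i x * diff g n i x) (vol L) := fun i =>
    (hφ.memLp_mid_grad hn i).integrable_mul
      (((hφ.hasGrad n hn).sub (hφ.hasGrad (n - 1) hn1)).2.1 i)
  have hf : Integrable (fun x => fMid φ n x * diff φ n x) (vol L) :=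
    (hφ.memLp_fMid hn).integrable_mul (hφ.memLp_diff hn)
  rw [energy, energy, ← integral_sub (integrable_energy_density (hφ.hasGrad n hn))
    (integrable_energy_density (hφ.hasGrad (n - 1) hn1)),
    ← integral_finsetSum _ fun i _ => hi i, ← integral_const_mul,
    ← integral_add hf ((integrable_finsetSum _ fun i _ => hi i).const_mul _)]
  congr 1
  -- The quartic part is `½(a²+b²) · ½(a+b) · (a-b) = ¼(a⁴-b⁴)`; the quadratic parts are products of
  -- a mean and a difference.
  ext x
  simp only [fMid, mid, diff, Fin.sum_univ_two, Pi.smul_apply, Pi.add_apply, Pi.sub_apply,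
    smul_eq_mul]
  ring

theorem IsCNSolution.integral_caputo_mul_diff (hφ : IsCNSolution L α κ ε t N φ g) {n : ℕ}
    (hn1 : 1 ≤ n) (hn : n ≤ N) :
    ∫ x, caputo α t φ n x * diff φ n x ∂(vol L)
      = -κ * (energy L ε (φ n) (g n) - energy L ε (φ (n - 1)) (g (n - 1))) := by
  rw [hφ.energy_sub hn]
  exact hφ.scheme_of_hasPeriodicGrad hn1 hn
    ((hφ.hasGrad n hn).sub (hφ.hasGrad (n - 1) (by omega)))

/-! ### The energy law -/

theorem vSeq_apply (α : ℝ) (t : ℕ → ℝ) (φ : ℕ → (Fin 2 → ℝ) → ℝ) (j : ℕ) (x : Fin 2 → ℝ) :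
    vSeq α t φ j x
      = ∑ l ∈ Finset.Icc 1 j, modKernel (1 - α) t j l * diff (fun k => φ k x) l := by
  simp [vSeq, diff]

/-- The correction for the doubled diagonal turns `2 · caputo · ∇φ^n` into `2 v^n ∇φ^n - 𝖺_0
(∇φ^n)²`, the right side of `sum_doc_mul_sq_add` because `θ_0 = 1/𝖺_0`. -/
theorem caputo_apply (α : ℝ) (t : ℕ → ℝ) (φ : ℕ → (Fin 2 → ℝ) → ℝ) {n : ℕ} (hn : 1 ≤ n)
    (x : Fin 2 → ℝ) :
    caputo α t φ n x
      = vSeq α t φ n x - 1 / 2 * modKernel (1 - α) t n n * diff φ n x := by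
  obtain ⟨m, rfl⟩ : ∃ m, n = m + 1 := ⟨n - 1, by omega⟩
  simp only [caputo, vSeq]
  rw [Finset.sum_Icc_succ_top (by omega), Finset.sum_Icc_succ_top (by omega),
    Finset.sum_congr rfl (g := fun k => modKernel (1 - α) t (m + 1) k • diff φ k) fun k hk => by
      rw [modKernel, if_neg (by have := (Finset.mem_Icc.mp hk).2; omega)]]
  simp only [Pi.add_apply, Pi.smul_apply, smul_eq_mul, modKernel, if_true]
  ring

/-- The integrated form of the algebraic identity behind the discrete energy law. -/
theorem IsCNSolution.two_mul_integral_caputo_mul_diff (hφ : IsCNSolution L α κ ε t N φ g) {n : ℕ}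
    (hn1 : 1 ≤ n) (hn : n ≤ N)
    (ha : ∀ k, 1 ≤ k → k ≤ n → modKernel (1 - α) t k k ≠ 0)
    (hP : ∀ k, 1 ≤ k → k ≤ n → rcc (modKernel (1 - α) t) n k ≠ 0) :
    2 * ∫ x, caputo α t φ n x * diff φ n x ∂(vol L)
      = ∑ j ∈ Finset.Icc 1 n, doc (modKernel (1 - α) t) n j * normSq L (vSeq α t φ j)
        + ∑ j ∈ Finset.Icc 1 (n - 1),
          (1 / rcc (modKernel (1 - α) t) n j - 1 / rcc (modKernel (1 - α) t) n (j + 1)) *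
            normSq L (∑ k ∈ Finset.Icc 1 j,
              rcc (modKernel (1 - α) t) n k • diff (vSeq α t φ) k) := by
  set a := modKernel (1 - α) t with hadef
  have h24 : (2 : ENNReal) ≤ 4 := by norm_num
  have hv : ∀ j ∈ Finset.Icc 1 n, Integrable (fun x => doc a n j * vSeq α t φ j x ^ 2) (vol L) :=
    fun j hj => (((hφ.memLp_vSeq ((Finset.mem_Icc.mp hj).2.trans hn)).mono_exponent
      h24).integrable_sq).const_mul _
  have hS : ∀ j ∈ Finset.Icc 1 (n - 1), Integrable (fun x =>
      (1 / rcc a n j - 1 / rcc a n (j + 1)) *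
        (∑ k ∈ Finset.Icc 1 j, rcc a n k • diff (vSeq α t φ) k) x ^ 2) (vol L) := by
    intro j hj
    refine MemLp.integrable_sq (MemLp.mono_exponent ?_ h24) |>.const_mul _
    refine memLp_finsetSum' _ fun k hk => MemLp.const_smul ?_ _
    have hj' := Finset.mem_Icc.mp hj
    have hk' := Finset.mem_Icc.mp hk
    exact (hφ.memLp_vSeq (by omega)).sub (hφ.memLp_vSeq (by omega))
  simp only [normSq, ← integral_const_mul]
  rw [← integral_finsetSum _ hv, ← integral_finsetSum _ hS,
    ← integral_add (integrable_finsetSum _ hv) (integrable_finsetSum _ hS)]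
  congr 1
  ext x
  have e := sum_doc_mul_sq_add hn1 hP (fun k => vSeq α t φ k x) (by simp [vSeq])
  have e2 : ∑ j ∈ Finset.Icc 1 n, doc a n j * vSeq α t φ j x = diff φ n x := by
    simp_rw [vSeq_apply]
    exact sum_doc_mul_convolution hn1 ha (fun l => diff (fun k => φ k x) l)
  rw [e2, doc_self] at e
  have e3 : ∀ j, (∑ k ∈ Finset.Icc 1 j, rcc a n k • diff (vSeq α t φ) k) x
      = ∑ k ∈ Finset.Icc 1 j, rcc a n k * diff (fun k => vSeq α t φ k x) k := by
    intro j
    simp [diff]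
  simp_rw [e3]
  rw [e, caputo_apply α t φ hn1, ← hadef]
  have := ha n hn1 le_rfl
  field_simp

theorem diff_energyAlpha {n : ℕ} (hn1 : 1 ≤ n) :
    diff (energyAlpha L α κ ε t φ g) n
      = energy L ε (φ n) (g n) - energy L ε (φ (n - 1)) (g (n - 1))
        + 1 / (2 * κ) * ∑ j ∈ Finset.Icc 1 n,
          doc (modKernel (1 - α) t) n j * normSq L (vSeq α t φ j) := by
  rw [← diff_sum_dcc_mul _ (fun j => normSq L (vSeq α t φ j)) hn1]
  simp only [diff, energyAlpha]
  ring

end Energy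

end TFAC

/-- With `P n k` the RCC kernel `p̃_{n-k}^{(1-α,n)}` of the modified kernels, the discrete energy
law holds at every time level, its kernels are positive, and its memory term is dissipative. -/
theorem mainTheorem4 (L : Fin 2 → ℝ) (hL : ∀ i, 0 < L i)
    (α κ ε : ℝ) (hα0 : 0 < α) (hα1 : α < 1) (hκ : 0 < κ) (hε : 0 < ε)
    (N : ℕ) (t : ℕ → ℝ) (ht0 : t 0 = 0) (ht : ∀ k, 1 ≤ k → k ≤ N → t (k - 1) < t k)
    (hr : TFAC.StepRatioConstraint (1 - α) t N)
    (φ : ℕ → (Fin 2 → ℝ) → ℝ) (g : ℕ → Fin 2 → (Fin 2 → ℝ) → ℝ)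
    (hφ : TFAC.IsCNSolution L α κ ε t N φ g)
    (P : ℕ → ℕ → ℝ) (hP : P = TFAC.rcc (TFAC.modKernel (1 - α) t))
    (n : ℕ) (hn1 : 1 ≤ n) (hnN : n ≤ N) :
    TFAC.diff (TFAC.energyAlpha L α κ ε t φ g) n / TFAC.step t n
        + 1 / (2 * κ * TFAC.step t n) *
          ∑ j ∈ Finset.Icc 1 (n - 1), (1 / P n j - 1 / P n (j + 1)) *
            TFAC.normSq L (∑ k ∈ Finset.Icc 1 j, P n k • TFAC.diff (TFAC.vSeq α t φ) k) = 0
      ∧ (∀ k, 1 ≤ k → k ≤ n → 0 < P n k)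
      ∧ (∀ j, 1 ≤ j → j ≤ n - 1 → 0 ≤ 1 / P n j - 1 / P n (j + 1))
      ∧ TFAC.energyAlpha L α κ ε t φ g n ≤ TFAC.energyAlpha L α κ ε t φ g (n - 1) := by

  have hβ : 0 < 1 - α := by linarith
  have hβ1 : 1 - α < 1 := by linarith
  subst hP
  have hpos := TFAC.rcc_modKernel_pos hβ hβ1 ht hr hnN
  have hcoef : ∀ j, 1 ≤ j → j ≤ n - 1 →
      0 ≤ 1 / TFAC.rcc (TFAC.modKernel (1 - α) t) n j
        - 1 / TFAC.rcc (TFAC.modKernel (1 - α) t) n (j + 1) := fun j hj hjn =>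
    sub_nonneg.mpr (one_div_le_one_div_of_le (hpos j hj (by omega))
      (TFAC.rcc_le_rcc_succ (TFAC.doc_modKernel_nonpos hβ hβ1 ht hr hnN) hj (by omega)))
  have hid := hφ.two_mul_integral_caputo_mul_diff hn1 hnN
    (fun k h1 h2 => (TFAC.modKernel_pos hβ ht h1 le_rfl (h2.trans hnN)).ne')
    (fun k h1 h2 => (hpos k h1 h2).ne')
  rw [hφ.integral_caputo_mul_diff hn1 hnN] at hid
  have hdiff := TFAC.diff_energyAlpha (L := L) (α := α) (κ := κ) (ε := ε) (t := t) (φ := φ)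
    (g := g) hn1
  set D := ∑ j ∈ Finset.Icc 1 (n - 1), (1 / TFAC.rcc (TFAC.modKernel (1 - α) t) n j
      - 1 / TFAC.rcc (TFAC.modKernel (1 - α) t) n (j + 1)) *
    TFAC.normSq L (∑ k ∈ Finset.Icc 1 j,
      TFAC.rcc (TFAC.modKernel (1 - α) t) n k • TFAC.diff (TFAC.vSeq α t φ) k) with hD
  have hD0 : 0 ≤ D := Finset.sum_nonneg fun j hj =>
    mul_nonneg (hcoef j (Finset.mem_Icc.mp hj).1 (Finset.mem_Icc.mp hj).2)
      (MeasureTheory.integral_nonneg fun x => sq_nonneg _)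
  have hlaw : TFAC.diff (TFAC.energyAlpha L α κ ε t φ g) n = -(1 / (2 * κ) * D) := by
    have hD' : D = 2 * (-κ * (TFAC.energy L ε (φ n) (g n)
        - TFAC.energy L ε (φ (n - 1)) (g (n - 1)))) - ∑ j ∈ Finset.Icc 1 n,
          TFAC.doc (TFAC.modKernel (1 - α) t) n j * TFAC.normSq L (TFAC.vSeq α t φ j) := by
      linarith
    rw [hdiff, hD']
    field_simp
    ring
  have hτ : TFAC.step t n ≠ 0 := (TFAC.step_pos ht hn1 hnN).ne'
  refine ⟨?_, hpos, hcoef, ?_⟩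
  · rw [hlaw]
    field_simp
    ring
  · have h0 : 0 ≤ 1 / (2 * κ) * D := by positivity
    have : TFAC.energyAlpha L α κ ε t φ g n - TFAC.energyAlpha L α κ ε t φ g (n - 1) ≤ 0 := by
      change TFAC.diff (TFAC.energyAlpha L α κ ε t φ g) n ≤ 0
      linarith
    linarith
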